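/- Let $q>0$ and let $[x]=\frac{q^x-q^{-x}}{q-q^{-1}}$ be the $q$-numbers (with $[x]=x$ for $q=1$), $[n]!=[n][n-1]\cdots[1]$, $[0]!=1$. **Setting.** A representation of $u_q(2,1)$ is given by operators $A_{ij}$ ($1\le i,j\le 3$) on a complex pre-Hilbert space with $[A_{ii},A_{jj}]=0$, $[A_{ii},A_{jk}]=(\delta_{ij}-\delta_{ik})A_{jk}$ for $j\ne k$, $[A_{12},A_{21}]=[A_{11}-A_{22}]$, $[A_{23},A_{32}]=[A_{22}-A_{33}]$ (the right-hand sides are $q$-numbers of weight operators, acting on weight vectors as scalars), $[A_{12},A_{32}]=[A_{21},A_{23}]=0$, the $q$-Serre relations $X^2Y-(q+q^{-1})XYX+YX^2=0$ for $\{X,Y\}=\{A_{12},A_{23}\}$ and $\{X,Y\}=\{A_{21},A_{32}\}$ (in both orders), and $A_{13}=A_{12}A_{23}-qA_{23}A_{12}$, $A_{31}=A_{32}A_{21}-q^{-1}A_{21}A_{32}$. It is unitary if $A_{ii}^+=A_{ii}$, $A_{12}^+=A_{21}$, $A_{23}^+=-A_{32}$ (hence $A_{13}^+=-(A_{32}A_{21}-qA_{21}A_{32})$),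 and irreducible if it has no proper nonzero invariant subspace. Let $f_1,f_2,f_3$ be integers with $f_1\ge f_2$, $f_1-f_3\ge1$ and, unless $f_1=f_2$, also $f_2-f_3\ge 2$. Consider a unitary irreducible representation of $u_q(2,1)$ with a lowest weight vector $|L\rangle$ of weight $(f_1,f_2,f_3)$ (positive discrete series): $A_{ii}|L\rangle=f_i|L\rangle$, $A_{31}|L\rangle=A_{32}|L\rangle=A_{12}|L\rangle=0$, $\langle L|L\rangle=1$. For integers $0\le k\le f_1-f_2$ and $\ell\ge0$ put $m_3=f_3-k-\ell$, $U=\frac12(f_1-f_2-k+\ell)$; let $M_U\in\{-U,-U+1,\dots,U\}$, and define $$|m_3UM_U\rangle=\frac{1}{N(k\ell)N(UM_U)}A_{21}^{U-M_U}P^UA_{23}^kA_{13}^\ell|L\rangle,$$ $$P^U=\sum_{r\ge0}(-1)^r\frac{[2U+1]!}{[r]!\,[2U+r+1]!}A_{21}^rA_{12}^r,\qquad N(UM_U)=\sqrt{\frac{[2U]!\,[U-M_U]!}{[U+M_U]!}},$$ where $N(k\ell)>0$ is the norm of $P^UA_{23}^kA_{13}^\ell|L\rangle$. **Claim.** These vectors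 form an orthonormal basis (algebraically spanning the space) of weight vectors, with $A_{ii}$-eigenvalues $m_1=f_1+\ell-(U-M_U)$, $m_2=f_2+k+(U-M_U)$, $m_3$. One has $$A_{12}|m_3UM_U\rangle=\sqrt{[U-M_U][U+M_U+1]}\,|m_3U\,M_U{+}1\rangle,\qquad A_{21}|m_3UM_U\rangle=\sqrt{[U+M_U][U-M_U+1]}\,|m_3U\,M_U{-}1\rangle$$ (zero when $M_U=U$, respectively $M_U=-U$). For the noncompact generators, $$A_{ij}|m_3UM_U\rangle=\sum_{U'=U\pm\frac12}a_{ij}(m_3'U'M_U')\,|m_3'U'M_U'\rangle,\qquad a_{ij}(m_3'U'M_U')=\langle m_3'U'M_U'|A_{ij}|m_3UM_U\rangle,$$ where $m_3'=m_3-1$ for $A_{13},A_{23}$, $m_3'=m_3+1$ for $A_{31},A_{32}$, $M_U'=M_U+\frac12$ for $A_{13},A_{32}$, $M_U'=M_U-\frac12$ for $A_{23},A_{31}$, and the sum runs over those $U'$ for which the target vector exists. Whenever the target vector exists, with $M=M_U$, $$a_{13}(m_3-1,U+\tfrac12,M+\tfrac12)=q^{-U+M}\left(\frac{[\ell+1][f_1-f_3+\ell][2U+k+2][U+M+1]}{[2U+1][2U+2]}\right)^{1/2},$$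 $$a_{23}(m_3-1,U+\tfrac12,M-\tfrac12)=\left(\frac{[\ell+1][f_1-f_3+\ell][2U+k+2][U-M+1]}{[2U+1][2U+2]}\right)^{1/2},$$ $$a_{13}(m_3-1,U-\tfrac12,M+\tfrac12)=-q^{U+M+1}\left(\frac{[k+1][f_2-f_3+k-1][2U-\ell][U-M]}{[2U][2U+1]}\right)^{1/2},$$ $$a_{23}(m_3-1,U-\tfrac12,M-\tfrac12)=\left(\frac{[k+1][f_2-f_3+k-1][2U-\ell][U+M]}{[2U][2U+1]}\right)^{1/2},$$ $$a_{31}(m_3+1,U-\tfrac12,M-\tfrac12)=-q^{U-M}\left(\frac{[\ell][f_1-f_3+\ell-1][2U+k+1][U+M]}{[2U][2U+1]}\right)^{1/2},$$ $$a_{32}(m_3+1,U-\tfrac12,M+\tfrac12)=-\left(\frac{[\ell][f_1-f_3+\ell-1][2U+k+1][U-M]}{[2U][2U+1]}\right)^{1/2},$$ $$a_{31}(m_3+1,U+\tfrac12,M-\tfrac12)=q^{-U-M-1}\left(\frac{[k][f_2-f_3+k-2][2U-\ell+1][U-M+1]}{[2U+1][2U+2]}\right)^{1/2},$$ $$a_{32}(m_3+1,U+\tfrac12,M+\tfrac12)=-\left(\frac{[k][f_2-f_3+k-2][2U-\ell+1][U+M+1]}{[2U+1][2U+2]}\right)^{1/2}.$$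 -/

import Mathlib

/-- The `q`-number `[x] = (q^x - q^(-x)) / (q - q⁻¹)`, with its limit value `[x] = x` at `q = 1`. -/
noncomputable def qNum (q x : ℝ) : ℝ :=
  if q = 1 then x else (q ^ x - q ^ (-x)) / (q - q⁻¹)

/-- The `q`-factorial `[n]! = [n][n-1]⋯[1]`, `[0]! = 1`. -/
noncomputable def qFactorial (q : ℝ) (n : ℕ) : ℝ :=
  ∏ i ∈ Finset.range n, qNum q ((i : ℝ) + 1)

/-- `v` is a vector of weight `(m 0, m 1, m 2)` for the three weight generators `A i i`. -/
def IsWeightVector {V : Type*} [AddCommGroup V] [Module ℂ V]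
    (A : Fin 3 → Fin 3 → Module.End ℂ V) (m : Fin 3 → ℝ) (v : V) : Prop :=
  ∀ i, A i i v = (m i : ℂ) • v

/-- The nine operators `A i j` satisfy the commutation relations of `u_q(3)` (equivalently, of
`u_q(2,1)`, which differs only in its Hermitian conjugation). Indices run over `0, 1, 2`, so that
`A 0 2` is the generator usually written `A₁₃`. The operator `[A_ii - A_jj]`, the `q`-number of
a weight operator, acts on vectors of weight `m` as the scalar `[m_i - m_j]`. -/
structure IsUqRep {V : Type*} [AddCommGroup V] [Module ℂ V] (q : ℝ)
    (A : Fin 3 → Fin 3 → Module.End ℂ V) : Prop where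
  cartan_comm : ∀ i j, A i i * A j j = A j j * A i i
  weight_comm : ∀ i j k, j ≠ k → A i i * A j k - A j k * A i i =
    ((if i = j then 1 else 0) - (if i = k then 1 else 0) : ℂ) • A j k
  comm_12_21 : ∀ (m : Fin 3 → ℝ) (v : V), IsWeightVector A m v →
    (A 0 1 * A 1 0 - A 1 0 * A 0 1) v = (qNum q (m 0 - m 1) : ℂ) • v
  comm_23_32 : ∀ (m : Fin 3 → ℝ) (v : V), IsWeightVector A m v →
    (A 1 2 * A 2 1 - A 2 1 * A 1 2) v = (qNum q (m 1 - m 2) : ℂ) • v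
  comm_12_32 : A 0 1 * A 2 1 = A 2 1 * A 0 1
  comm_21_23 : A 1 0 * A 1 2 = A 1 2 * A 1 0
  def_13 : A 0 2 = A 0 1 * A 1 2 - (q : ℂ) • (A 1 2 * A 0 1)
  def_31 : A 2 0 = A 2 1 * A 1 0 - ((q⁻¹ : ℝ) : ℂ) • (A 1 0 * A 2 1)
  serre_12_23 : A 0 1 * A 0 1 * A 1 2 - ((q + q⁻¹ : ℝ) : ℂ) • (A 0 1 * A 1 2 * A 0 1) +
    A 1 2 * A 0 1 * A 0 1 = 0
  serre_23_12 : A 1 2 * A 1 2 * A 0 1 - ((q + q⁻¹ : ℝ) : ℂ) • (A 1 2 * A 0 1 * A 1 2) +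
    A 0 1 * A 1 2 * A 1 2 = 0
  serre_21_32 : A 1 0 * A 1 0 * A 2 1 - ((q + q⁻¹ : ℝ) : ℂ) • (A 1 0 * A 2 1 * A 1 0) +
    A 2 1 * A 1 0 * A 1 0 = 0
  serre_32_21 : A 2 1 * A 2 1 * A 1 0 - ((q + q⁻¹ : ℝ) : ℂ) • (A 2 1 * A 1 0 * A 2 1) +
    A 1 0 * A 2 1 * A 2 1 = 0

/-- The Hermitian conjugation of `u_q(2,1)`: `A_ii⁺ = A_ii`, `A₁₂⁺ = A₂₁`, `A₂₃⁺ = -A₃₂`.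
The rule `A₁₃⁺ = -(A₃₂ A₂₁ - q A₂₁ A₃₂)` is a consequence. -/
structure IsU21Unitary {V : Type*} [NormedAddCommGroup V] [InnerProductSpace ℂ V]
    (A : Fin 3 → Fin 3 → Module.End ℂ V) : Prop where
  adj_diag : ∀ i x y, inner ℂ (A i i x) y = inner ℂ x (A i i y)
  adj_12 : ∀ x y, inner ℂ (A 0 1 x) y = inner ℂ x (A 1 0 y)
  adj_23 : ∀ x y, inner ℂ (A 1 2 x) y = -inner ℂ x (A 2 1 y)

/-- The operators `A i j` on the pre-Hilbert space `V` form a unitary irreducible representation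
of `u_q(2,1)` with normalized lowest weight vector `L` of weight `f`. -/
structure IsLowestWeightUIR {V : Type*} [NormedAddCommGroup V] [InnerProductSpace ℂ V] (q : ℝ)
    (f : Fin 3 → ℤ) (A : Fin 3 → Fin 3 → Module.End ℂ V) (L : V) : Prop where
  rep : IsUqRep q A
  unitary : IsU21Unitary A
  irreducible : ∀ W : Submodule ℂ V, (∀ i j, ∀ v ∈ W, A i j v ∈ W) → W = ⊥ ∨ W = ⊤
  weight : IsWeightVector A (fun i => (f i : ℝ)) L
  lower_31 : A 2 0 L = 0
  lower_32 : A 2 1 L = 0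
  raise_12 : A 0 1 L = 0
  norm_one : ‖L‖ = 1

/-- The signatures `f = (f₁, f₂, f₃)` of the positive discrete series: `f₁ ≥ f₂`, `f₁ - f₃ ≥ 1`,
`f₂ - f₃ ≥ 2`, where the last condition is dropped when `f₁ = f₂`. -/
def IsPositiveSignature (f : Fin 3 → ℤ) : Prop :=
  f 1 ≤ f 0 ∧ 1 ≤ f 0 - f 2 ∧ (2 ≤ f 1 - f 2 ∨ f 0 = f 1)

/-- The labels of the `U`-spin basis: `0 ≤ k ≤ f₁ - f₂`, `0 ≤ l` and
`0 ≤ r = U - M_U ≤ 2U = f₁ - f₂ - k + l`. -/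
structure ULabel (f : Fin 3 → ℤ) where
  k : ℕ
  l : ℕ
  r : ℕ
  hk : (k : ℤ) ≤ f 0 - f 1
  hr : (r : ℤ) ≤ f 0 - f 1 - k + l

namespace ULabel

variable {f : Fin 3 → ℤ}

/-- `m₃ = f₃ - k - l`. -/
def m3 (x : ULabel f) : ℤ := f 2 - x.k - x.l

/-- The natural number `2U = f₁ - f₂ - k + l`. -/
def twoU (x : ULabel f) : ℕ := (f 0 - f 1 - x.k + x.l).toNat

/-- The `U`-spin `U = (f₁ - f₂ - k + l) / 2`. -/
noncomputable def U (x : ULabel f) : ℝ := ((f 0 : ℝ) - f 1 - x.k + x.l) / 2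

/-- The projection `M_U = U - r` of the `U`-spin. -/
noncomputable def M (x : ULabel f) : ℝ := x.U - x.r

end ULabel

section UBasis

variable {V : Type*} [NormedAddCommGroup V] [InnerProductSpace ℂ V]

/-- The projection operator of the `U`-spin subalgebra,
`P^U v = ∑_s (-1)^s [2U+1]! / ([s]! [2U+s+1]!) A₂₁^s A₁₂^s v` with `n = 2U`
(a finite sum on every vector killed by some power of `A₁₂`). -/
noncomputable def projU (q : ℝ) (A : Fin 3 → Fin 3 → Module.End ℂ V) (n : ℕ) (v : V) : V :=
  ∑ᶠ s : ℕ, (((-1) ^ s * qFactorial q (n + 1) /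
    (qFactorial q s * qFactorial q (n + s + 1)) : ℝ) : ℂ) • (A 1 0 ^ s) ((A 0 1 ^ s) v)

/-- The unnormalized `U`-highest vector `P^U A₂₃^k A₁₃^l |L⟩`. -/
noncomputable def uHighest (q : ℝ) {f : Fin 3 → ℤ} (A : Fin 3 → Fin 3 → Module.End ℂ V) (L : V)
    (x : ULabel f) : V :=
  projU q A x.twoU ((A 1 2 ^ x.k) ((A 0 2 ^ x.l) L))

/-- `N(U M_U) = ([2U]! [U-M_U]! / [U+M_U]!)^(1/2)`. -/
noncomputable def uNormFactor (q : ℝ) {f : Fin 3 → ℤ} (x : ULabel f) : ℝ :=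
  √(qFactorial q x.twoU * qFactorial q x.r / qFactorial q (x.twoU - x.r))

/-- The vector `|⟨f⟩ m₃ U M_U⟩ = (N(kl) N(U M_U))⁻¹ A₂₁^(U-M_U) P^U A₂₃^k A₁₃^l |L⟩`, where the
normalization factor `N(kl)` is the norm of `P^U A₂₃^k A₁₃^l |L⟩`. -/
noncomputable def uKet (q : ℝ) {f : Fin 3 → ℤ} (A : Fin 3 → Fin 3 → Module.End ℂ V) (L : V)
    (x : ULabel f) : V :=
  (((‖uHighest q A L x‖ * uNormFactor q x)⁻¹ : ℝ) : ℂ) • (A 1 0 ^ x.r) (uHighest q A L x)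

end UBasis

/-! Write E, F, B, C, D, G for `A 0 1`, `A 1 0`, `A 1 2`, `A 2 1`, `A 0 2`, `A 2 0`; the lemma names
use these letters. E and F span the U-spin algebra, and everything reduces to vectors killed by E.
On such a vector of spin n/2, D and C give vectors killed by E of spin (n+1)/2, while R =
`lowerHighest` (B corrected by F D) and T = `lowerHighest'` (C F corrected by F C) give ones of spin
(n-1)/2. These four step operators satisfy closed relations: `C_D`, `D_lowerHighest`,
`lowerHighest_C`, `lowerHighest'_D`, `lowerHighest'_lowerHighest`.

Put h(k,l) = R^k D^l L. The lowest weight conditions amount to C L = T L = 0, and the relations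
propagate them: D, T, C send h(k,l) to explicit multiples of h(k,l+1), h(k,l-1), h(k-1,l)
(`D_highestVec`, `lowerHighest'_highestVec`, `C_highestVec`). On vectors killed by E, unitarity
makes -C adjoint to R and -T adjoint to D, so the same coefficients give the norm ratios. Hence
h(k,l) has norm zero, and vanishes, for k > f₁ - f₂, and is nonzero otherwise by the conditions on
f.

Every generator maps F^r h(k,l) (`spinVec`) to a combination of at most two such vectors. They are
mutually orthogonal, and their span is invariant, hence everything by irreducibility. Finally B^k
D^l L differs from h(k,l) by a vector in the image of F, which P^U kills (`projU_add_F`), so the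
kets are exactly the normalized `spinVec`. A matrix element is then a coefficient times a ratio of
norms, whence the square roots. -/

/-! ### Identities for q-numbers. -/

section QNumbers

variable {q : ℝ}

theorem qNum_zero (q : ℝ) : qNum q 0 = 0 := by simp [qNum]

theorem qNum_neg (q x : ℝ) : qNum q (-x) = -qNum q x := by
  unfold qNum
  split_ifs
  · rfl
  · rw [neg_neg]; ring

theorem sub_inv_ne_zero (hq : 0 < q) (h1 : q ≠ 1) : q - q⁻¹ ≠ 0 := by
  intro h
  apply h1
  have h2 : q * q = 1 := by field_simp at h; nlinarith
  nlinarith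

theorem qNum_one (hq : 0 < q) : qNum q 1 = 1 := by
  unfold qNum
  split_ifs with h
  · rfl
  · rw [Real.rpow_one, Real.rpow_neg_one, div_self (sub_inv_ne_zero hq h)]

theorem qNum_pos (hq : 0 < q) {x : ℝ} (hx : 0 < x) : 0 < qNum q x := by
  unfold qNum
  split_ifs with h
  · exact hx
  · rcases lt_or_gt_of_ne h with h | h
    · have h1 : q ^ x < q ^ (-x) := Real.rpow_lt_rpow_of_exponent_gt hq h (by linarith)
      have h2 : q < q⁻¹ := h.trans (one_lt_inv_iff₀.2 ⟨hq, h⟩)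
      exact div_pos_of_neg_of_neg (by linarith) (by linarith)
    · have h1 : q ^ (-x) < q ^ x := Real.rpow_lt_rpow_of_exponent_lt h (by linarith)
      have h2 : q⁻¹ < q := (inv_lt_one_of_one_lt₀ h).trans h
      exact div_pos (by linarith) (by linarith)

theorem qNum_nonneg (hq : 0 < q) {x : ℝ} (hx : 0 ≤ x) : 0 ≤ qNum q x := by
  rcases hx.eq_or_lt with h | h
  · rw [← h, qNum_zero]
  · exact (qNum_pos hq h).le

/-- The addition formula `[x + y] = q^y [x] + q^(-x) [y]`. -/
theorem qNum_add (hq : 0 < q) (x y : ℝ) :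
    qNum q (x + y) = q ^ y * qNum q x + q ^ (-x) * qNum q y := by
  unfold qNum
  split_ifs with h
  · simp [h]
  · have := sub_inv_ne_zero hq h
    rw [neg_add, Real.rpow_add hq, Real.rpow_add hq, mul_div_assoc', mul_div_assoc',
      ← add_div]
    ring

/-- The three-term identity `[x + z] [y + z] - [x] [y] = [z] [x + y + z]`. -/
theorem qNum_three_term (hq : 0 < q) (x y z : ℝ) :
    qNum q (x + z) * qNum q (y + z) - qNum q x * qNum q y = qNum q z * qNum q (x + y + z) := by
  by_cases h : q = 1
  · simp only [qNum, h, if_true]; ring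
  · have h1 := sub_inv_ne_zero hq h
    have hx := (Real.rpow_pos_of_pos hq x).ne'
    have hy := (Real.rpow_pos_of_pos hq y).ne'
    have hz := (Real.rpow_pos_of_pos hq z).ne'
    simp only [qNum, h, if_false, Real.rpow_add hq, Real.rpow_neg hq.le]
    generalize q ^ x = X at *
    generalize q ^ y = Y at *
    generalize q ^ z = Z at *
    generalize q - q⁻¹ = Q at *
    field_simp
    ring

theorem qNum_two (hq : 0 < q) : qNum q 2 = q + q⁻¹ := by
  have h := qNum_add hq 1 1
  rw [qNum_one hq, Real.rpow_one, Real.rpow_neg_one] at h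
  norm_num at h
  exact h

/-- `q^x = q [x] - [x - 1]`. -/
theorem rpow_eq_qNum (hq : 0 < q) (x : ℝ) : q ^ x = q * qNum q x - qNum q (x - 1) := by
  have h2 := qNum_add hq 1 (x - 1)
  rw [add_sub_cancel, Real.rpow_neg_one, qNum_one hq] at h2
  have h3 : q ^ (x - 1) = q ^ x * q⁻¹ := by rw [Real.rpow_sub hq, Real.rpow_one]; rfl
  rw [h3] at h2
  rw [h2]
  field_simp
  ring

/-- `q^(-x) = [x + 1] - q [x]`. -/
theorem rpow_neg_eq_qNum (hq : 0 < q) (x : ℝ) : q ^ (-x) = qNum q (x + 1) - q * qNum q x := by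
  rw [qNum_add hq, qNum_one hq, Real.rpow_one]; ring

theorem qNum_recurrence (hq : 0 < q) (x : ℝ) :
    qNum q (x + 1) = (q + q⁻¹) * qNum q x - qNum q (x - 1) := by
  have h := qNum_three_term hq (x - 1) 1 1
  rw [qNum_one hq] at h
  norm_num at h
  rw [qNum_two hq] at h
  linarith

theorem qNum_sq (hq : 0 < q) (x : ℝ) :
    qNum q x ^ 2 = qNum q (x + 1) * qNum q (x - 1) + 1 := by
  -- With z = 1 - x both factors of the leading product become [1].
  have h := qNum_three_term hq x x (1 - x)
  rw [add_sub_cancel, add_assoc x x, add_sub_cancel, qNum_one hq, ← neg_sub x 1, qNum_neg] at h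
  linear_combination -h

/-- The identity behind the recursion in `k` of the norms of the highest vectors. -/
theorem qNum_norm_recursion (hq : 0 < q) (k a N l : ℝ) :
    qNum q (k + 1) * qNum q (a + k - 1) * qNum q (N - k) * qNum q (N - k + l + 2) =
      qNum q k * qNum q (a + k - 2) * qNum q (N - k + 1) * qNum q (N - k + l + 1) +
      qNum q (a + 2 * k + l) * qNum q (N - k + l + 1) * qNum q (N - k + l + 2) -
      qNum q (N + l + 2) * qNum q (l + 1) * qNum q (N + a + l) := by
  by_cases h : q = 1
  · simp only [qNum, h, if_true]; ring
  · have h1 := sub_inv_ne_zero hq h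
    have hk := (Real.rpow_pos_of_pos hq k).ne'
    have ha := (Real.rpow_pos_of_pos hq a).ne'
    have hN := (Real.rpow_pos_of_pos hq N).ne'
    have hl := (Real.rpow_pos_of_pos hq l).ne'
    have hk2 : q ^ (2 * k) = q ^ k * q ^ k := by rw [two_mul, Real.rpow_add hq]
    have e2 : q ^ (2 : ℝ) = q * q := by rw [Real.rpow_two]; ring
    have hq' := hq.ne'
    have h3 : q ^ 2 - 1 ≠ 0 := by
      intro h4; apply h1; field_simp; simpa using h4
    simp only [qNum, h, if_false, Real.rpow_add hq, Real.rpow_sub hq, Real.rpow_neg hq.le, hk2, e2,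
      Real.rpow_one]
    generalize q ^ k = K at *
    generalize q ^ a = X at *
    generalize q ^ N = Z at *
    generalize q ^ l = Y at *
    have e : q - q⁻¹ = (q ^ 2 - 1) / q := by field_simp
    rw [e]
    field_simp
    ring

end QNumbers

/-! ### Commutation relations, and the step operators between U-highest vectors. -/

section HighestVectors

variable {V : Type*} [AddCommGroup V] [Module ℂ V] {q : ℝ} {A : Fin 3 → Fin 3 → Module.End ℂ V}

theorem IsWeightVector.congr {a b c a' b' c' : ℝ} {v : V} (h : IsWeightVector A ![a, b, c] v)
    (ha : a = a') (hb : b = b') (hc : c = c') : IsWeightVector A ![a', b', c'] v := by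
  subst ha hb hc; exact h

theorem IsWeightVector.add {m : Fin 3 → ℝ} {v w : V} (hv : IsWeightVector A m v)
    (hw : IsWeightVector A m w) : IsWeightVector A m (v + w) := fun i => by
  rw [map_add, hv i, hw i, smul_add]

theorem IsWeightVector.smul {m : Fin 3 → ℝ} {v : V} (hv : IsWeightVector A m v) (x : ℝ) :
    IsWeightVector A m (x • v) := fun i => by
  rw [LinearMap.map_smul_of_tower, hv i, smul_comm]

theorem IsWeightVector.sub {m : Fin 3 → ℝ} {v w : V} (hv : IsWeightVector A m v)
    (hw : IsWeightVector A m w) : IsWeightVector A m (v - w) := fun i => by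
  rw [map_sub, hv i, hw i, smul_sub]

namespace IsUqRep

theorem weight_shift (hA : IsUqRep q A) {j k : Fin 3} (hjk : j ≠ k) {m : Fin 3 → ℝ} {v : V}
    (hv : IsWeightVector A m v) :
    IsWeightVector A (fun i => m i + ((if i = j then 1 else 0) - (if i = k then 1 else 0)))
      (A j k v) := fun i => by
  have h := LinearMap.congr_fun (hA.weight_comm i j k hjk) v
  simp only [LinearMap.sub_apply, Module.End.mul_apply, LinearMap.smul_apply, hv i, map_smul] at h
  rw [sub_eq_iff_eq_add] at h
  rw [h, ← add_smul]
  congr 1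
  push_cast [apply_ite (Complex.ofReal)]
  ring

variable (hA : IsUqRep q A) {a b c : ℝ} {v : V}
include hA

theorem weight_12 (hv : IsWeightVector A ![a, b, c] v) :
    IsWeightVector A ![a + 1, b - 1, c] (A 0 1 v) := by
  convert hA.weight_shift (show (0 : Fin 3) ≠ 1 by decide) hv using 1
  ext i; fin_cases i <;> simp [sub_eq_add_neg]

theorem weight_21 (hv : IsWeightVector A ![a, b, c] v) :
    IsWeightVector A ![a - 1, b + 1, c] (A 1 0 v) := by
  convert hA.weight_shift (show (1 : Fin 3) ≠ 0 by decide) hv using 1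
  ext i; fin_cases i <;> simp [sub_eq_add_neg]

theorem weight_23 (hv : IsWeightVector A ![a, b, c] v) :
    IsWeightVector A ![a, b + 1, c - 1] (A 1 2 v) := by
  convert hA.weight_shift (show (1 : Fin 3) ≠ 2 by decide) hv using 1
  ext i; fin_cases i <;> simp [sub_eq_add_neg]

theorem weight_32 (hv : IsWeightVector A ![a, b, c] v) :
    IsWeightVector A ![a, b - 1, c + 1] (A 2 1 v) := by
  convert hA.weight_shift (show (2 : Fin 3) ≠ 1 by decide) hv using 1
  ext i; fin_cases i <;> simp [sub_eq_add_neg]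

theorem weight_13 (hv : IsWeightVector A ![a, b, c] v) :
    IsWeightVector A ![a + 1, b, c - 1] (A 0 2 v) := by
  convert hA.weight_shift (show (0 : Fin 3) ≠ 2 by decide) hv using 1
  ext i; fin_cases i <;> simp [sub_eq_add_neg]

theorem comm_EF (hv : IsWeightVector A ![a, b, c] v) :
    A 0 1 (A 1 0 v) = A 1 0 (A 0 1 v) + qNum q (a - b) • v := by
  have h := hA.comm_12_21 _ v hv
  simp only [LinearMap.sub_apply, Module.End.mul_apply, Complex.coe_smul] at h
  rw [← sub_eq_iff_eq_add', h]; rfl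

theorem comm_CB (hv : IsWeightVector A ![a, b, c] v) :
    A 2 1 (A 1 2 v) = A 1 2 (A 2 1 v) - qNum q (b - c) • v := by
  have h := hA.comm_23_32 _ v hv
  simp only [LinearMap.sub_apply, Module.End.mul_apply, Complex.coe_smul] at h
  have h' : A 1 2 (A 2 1 v) - A 2 1 (A 1 2 v) = qNum q (b - c) • v := h
  rw [← h']; abel

theorem comm_EC (v : V) : A 0 1 (A 2 1 v) = A 2 1 (A 0 1 v) :=
  LinearMap.congr_fun hA.comm_12_32 v

theorem comm_FB (v : V) : A 1 0 (A 1 2 v) = A 1 2 (A 1 0 v) :=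
  LinearMap.congr_fun hA.comm_21_23 v

theorem D_apply (v : V) : A 0 2 v = A 0 1 (A 1 2 v) - q • A 1 2 (A 0 1 v) := by
  have h := LinearMap.congr_fun hA.def_13 v
  simpa only [LinearMap.sub_apply, Module.End.mul_apply, LinearMap.smul_apply,
    Complex.coe_smul] using h

theorem G_apply (v : V) : A 2 0 v = A 2 1 (A 1 0 v) - q⁻¹ • A 1 0 (A 2 1 v) := by
  have h := LinearMap.congr_fun hA.def_31 v
  simpa only [LinearMap.sub_apply, Module.End.mul_apply, LinearMap.smul_apply,
    Complex.coe_smul] using h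

theorem EB_apply (v : V) : A 0 1 (A 1 2 v) = A 0 2 v + q • A 1 2 (A 0 1 v) := by
  rw [hA.D_apply]; abel

/-- This is a q-Serre relation regrouped: E D - q⁻¹ D E expands to E²B - (q + q⁻¹) E B E + B E².
`comm_DB` is the other one in the same way. -/
theorem comm_ED (hq : 0 < q) (v : V) : A 0 1 (A 0 2 v) = q⁻¹ • A 0 2 (A 0 1 v) := by
  have h := LinearMap.congr_fun hA.serre_12_23 v
  simp only [LinearMap.sub_apply, LinearMap.add_apply, Module.End.mul_apply, LinearMap.smul_apply,
    Complex.coe_smul, LinearMap.zero_apply] at h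
  simp only [hA.D_apply, map_sub, LinearMap.map_smul_of_tower]
  have hq' := hq.ne'
  linear_combination (norm := skip) h
  match_scalars <;> field_simp <;> ring

theorem comm_DB (hq : 0 < q) (v : V) : A 0 2 (A 1 2 v) = q⁻¹ • A 1 2 (A 0 2 v) := by
  have h := LinearMap.congr_fun hA.serre_23_12 v
  simp only [LinearMap.sub_apply, LinearMap.add_apply, Module.End.mul_apply, LinearMap.smul_apply,
    Complex.coe_smul, LinearMap.zero_apply] at h
  simp only [hA.D_apply, map_sub, LinearMap.map_smul_of_tower]
  have hq' := hq.ne'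
  linear_combination (norm := skip) h
  match_scalars <;> field_simp <;> ring

theorem comm_CFF (v : V) : A 2 1 (A 1 0 (A 1 0 v)) =
    (q + q⁻¹) • A 1 0 (A 2 1 (A 1 0 v)) - A 1 0 (A 1 0 (A 2 1 v)) := by
  have h := LinearMap.congr_fun hA.serre_21_32 v
  simp only [LinearMap.sub_apply, LinearMap.add_apply, Module.End.mul_apply, LinearMap.smul_apply,
    Complex.coe_smul, LinearMap.zero_apply] at h
  linear_combination (norm := module) h

theorem comm_DF (hq : 0 < q) (hv : IsWeightVector A ![a, b, c] v) :
    A 0 2 (A 1 0 v) = A 1 0 (A 0 2 v) - q ^ (a - b) • A 1 2 v := by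
  have h1 := hA.comm_EF (hA.weight_23 hv)
  have h2 := hA.comm_EF hv
  have e : a - (b + 1) = a - b - 1 := by ring
  rw [e] at h1
  rw [hA.D_apply, ← hA.comm_FB, h1, h2, hA.D_apply, rpow_eq_qNum hq]
  simp only [map_sub, map_add, LinearMap.map_smul_of_tower, hA.comm_FB]
  module

theorem comm_CD (hq : 0 < q) (hv : IsWeightVector A ![a, b, c] v) :
    A 2 1 (A 0 2 v) = A 0 2 (A 2 1 v) - q ^ (1 - (b - c)) • A 0 1 v := by
  have h1 := hA.comm_CB hv
  have h2 := hA.comm_CB (hA.weight_12 hv)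
  have e : b - 1 - c = b - c - 1 := by ring
  have e' : 1 - (b - c) = -(b - c - 1) := by ring
  rw [e] at h2
  rw [e', rpow_neg_eq_qNum hq, sub_add_cancel, hA.D_apply, hA.D_apply, map_sub,
    LinearMap.map_smul_of_tower, ← hA.comm_EC, h1, h2]
  simp only [map_sub, LinearMap.map_smul_of_tower, hA.comm_EC]
  module

end IsUqRep

/-- On a highest vector `w` of the `U`-spin `n / 2` this is the component of `A₂₃ w` which is a
highest vector of `U`-spin `(n - 1) / 2`. -/
noncomputable def lowerHighest (q : ℝ) (A : Fin 3 → Fin 3 → Module.End ℂ V) (n : ℝ) (w : V) : V :=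
  A 1 2 w - (qNum q (n + 1))⁻¹ • A 1 0 (A 0 2 w)

/-- On a highest vector `w` of the `U`-spin `n / 2` this is the component of `A₃₂ A₂₁ w` which is a
highest vector of `U`-spin `(n - 1) / 2`. -/
noncomputable def lowerHighest' (q : ℝ) (A : Fin 3 → Fin 3 → Module.End ℂ V) (n : ℝ) (w : V) :
    V :=
  A 2 1 (A 1 0 w) - (qNum q n / qNum q (n + 1)) • A 1 0 (A 2 1 w)

namespace IsUqRep

variable (hA : IsUqRep q A) (hq : 0 < q) {a b c n : ℝ} {w : V}
  (hw : IsWeightVector A ![a, b, c] w) (he : A 0 1 w = 0)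
include hA hq

omit hq in
theorem weight_lowerHighest (hw : IsWeightVector A ![a, b, c] w) (n : ℝ) :
    IsWeightVector A ![a, b + 1, c - 1] (lowerHighest q A n w) :=
  (hA.weight_23 hw).sub
    (((hA.weight_21 (hA.weight_13 hw)).congr (by ring) rfl rfl).smul _)

theorem raise_D (he : A 0 1 w = 0) : A 0 1 (A 0 2 w) = 0 := by
  rw [hA.comm_ED hq, he, map_zero, smul_zero]

include hw he

/-- E B w = D w because E w = 0, and E F D w = [n+1] D w because D w is again highest, of spin
(n+1)/2. This fixes the constant [n+1]⁻¹ in `lowerHighest`. -/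
theorem raise_lowerHighest (hn : n = a - b) (h1 : 0 < n + 1) :
    A 0 1 (lowerHighest q A n w) = 0 := by
  have hne := (qNum_pos hq h1).ne'
  have e : a + 1 - b = n + 1 := by rw [hn]; ring
  rw [lowerHighest, map_sub, LinearMap.map_smul_of_tower, hA.EB_apply,
    hA.comm_EF (hA.weight_13 hw), hA.raise_D hq he, he, e, map_zero, map_zero, smul_zero, zero_add,
    add_zero, smul_smul, inv_mul_cancel₀ hne, one_smul, sub_self]

theorem C_D : A 2 1 (A 0 2 w) = A 0 2 (A 2 1 w) := by
  rw [hA.comm_CD hq hw, he, smul_zero, sub_zero]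

omit he in
-- Both sides are combinations of B D w and F D D w. The coefficient of B D w on the left is q⁻¹ +
-- q^(n+1)/[n+1], which the recurrence for q-numbers turns into [n+2]/[n+1].
theorem D_lowerHighest (hn : n = a - b) (h1 : 0 < n + 1) :
    A 0 2 (lowerHighest q A n w) =
      (qNum q (n + 2) / qNum q (n + 1)) • lowerHighest q A (n + 1) (A 0 2 w) := by
  have hne := (qNum_pos hq h1).ne'
  have hne2 := (qNum_pos hq (show 0 < n + 2 by linarith)).ne'
  have e : a + 1 - b = n + 1 := by rw [hn]; ring
  have e2 : n + 1 + 1 = n + 2 := by ring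
  have h := rpow_eq_qNum hq (n + 1)
  have hr := qNum_recurrence hq (n + 1)
  rw [add_sub_cancel_right, e2] at hr
  rw [add_sub_cancel_right] at h
  rw [lowerHighest, lowerHighest, map_sub, LinearMap.map_smul_of_tower, hA.comm_DB hq,
    hA.comm_DF hq (hA.weight_13 hw), e, e2, h]
  match_scalars
  · field_simp
    rw [hr]
    field_simp
    ring
  · field_simp

/-- The term C F D w splits into its T-part and a multiple of F C D w = F D C w; the latter is
exactly what completes B C w to R C w. -/
theorem lowerHighest_C (h1 : 0 < n + 1) :
    A 2 1 (lowerHighest q A n w) = lowerHighest q A (n + 1) (A 2 1 w) - qNum q (b - c) • w -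
      (qNum q (n + 1))⁻¹ • lowerHighest' q A (n + 1) (A 0 2 w) := by
  have hne := (qNum_pos hq h1).ne'
  have hne2 := (qNum_pos hq (show 0 < n + 1 + 1 by linarith)).ne'
  simp only [lowerHighest, lowerHighest', map_sub, LinearMap.map_smul_of_tower, hA.comm_CB hw,
    hA.C_D hq hw he]
  match_scalars <;> field_simp
  ring

theorem lowerHighest'_D (hn : n = a - b) (h1 : 0 < n + 1) :
    lowerHighest' q A (n + 1) (A 0 2 w) = A 0 2 (lowerHighest' q A n w) +
      (qNum q (n + 1))⁻¹ • lowerHighest q A (n + 1) (A 2 1 w) - qNum q (a - c) • w := by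
  have hne := (qNum_pos hq h1).ne'
  have hne2 := (qNum_pos hq (show 0 < n + 1 + 1 by linarith)).ne'
  have hFw := hA.weight_21 hw
  have hEF := hA.comm_EF hw
  rw [he, map_zero, zero_add, ← hn] at hEF
  have hDF := hA.comm_DF hq hw
  have hDF' := hA.comm_DF hq (hA.weight_32 hw)
  have hCB := hA.comm_CB hw
  have hCD := hA.comm_CD hq hFw
  have e : a - (b - 1) = n + 1 := by rw [hn]; ring
  have e2 : 1 - (b + 1 - c) = -(b - c) := by ring
  rw [← hn] at hDF
  rw [e] at hDF'
  rw [e2, hEF, hDF, map_sub, LinearMap.map_smul_of_tower, hCB] at hCD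
  -- C F D w is obtained by evaluating C D F w in two ways: moving D past F, or C past D. The two
  -- scalar contributions on w combine to [a - c] by the addition formula.
  have hkey : A 2 1 (A 1 0 (A 0 2 w)) = A 0 2 (A 2 1 (A 1 0 w)) +
      q ^ n • A 1 2 (A 2 1 w) - (q ^ n * qNum q (b - c) + q ^ (-(b - c)) * qNum q n) • w := by
    linear_combination (norm := module) hCD
  have hadd := qNum_add hq (b - c) n
  have e3 : b - c + n = a - c := by rw [hn]; ring
  rw [e3] at hadd
  have hpow' : q ^ (n + 1) = q ^ n * q := by rw [Real.rpow_add hq, Real.rpow_one]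
  have h1' := rpow_neg_eq_qNum hq n
  have hmul : q ^ n * q ^ (-n) = 1 := by rw [← Real.rpow_add hq]; simp
  have hsq := qNum_sq hq (n + 1)
  rw [add_sub_cancel_right] at hsq
  rw [lowerHighest', hkey, ← hadd, lowerHighest', lowerHighest, hA.C_D hq hw he, map_sub,
    LinearMap.map_smul_of_tower, hDF']
  match_scalars
  · field_simp
  · field_simp
    rw [hpow']
    rw [h1'] at hmul
    linear_combination hmul
  · ring
  · field_simp
    linear_combination -hsq

/-- T and R commute, up to the shift of the spin parameter, so T acts on R^k w as it does on w. Both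
sides are expanded in the five vectors B T w, F T D w, F R C w, F F D C w and F w; the q-Serre
relation handles C F F, and D T w is eliminated through `lowerHighest'_D`. -/
theorem lowerHighest'_lowerHighest (hn : n = a - b) (h1 : 0 < n) :
    lowerHighest' q A (n - 1) (lowerHighest q A n w) =
      lowerHighest q A (n - 1) (lowerHighest' q A n w) := by
  have hne := (qNum_pos hq h1).ne'
  have hne1 := (qNum_pos hq (show 0 < n + 1 by linarith)).ne'
  have hne2 := (qNum_pos hq (show 0 < n + 1 + 1 by linarith)).ne'
  have hCR := hA.lowerHighest_C hq hw he (n := n) (by linarith)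
  have hTD := hA.lowerHighest'_D hq hw he hn (by linarith)
  have hCB := hA.comm_CB (hA.weight_21 hw)
  have hCFF := hA.comm_CFF (A 0 2 w)
  have e : b + 1 - c = b - c + 1 := by ring
  have h3 := qNum_three_term hq (n - 1) (b - c) 1
  have hsq := qNum_sq hq n
  have hqi := mul_inv_cancel₀ hq.ne'
  have hr := qNum_recurrence hq n
  have hr1 := qNum_recurrence hq (n + 1)
  have e3 : n - 1 + (b - c) + 1 = a - c := by rw [hn]; ring
  rw [sub_add_cancel, qNum_one hq, one_mul, e3] at h3
  rw [add_sub_cancel_right] at hr1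
  rw [e] at hCB
  have hT : A 2 1 (A 1 0 (A 0 2 w)) = lowerHighest' q A (n + 1) (A 0 2 w) +
      (qNum q (n + 1) / qNum q (n + 1 + 1)) • A 1 0 (A 0 2 (A 2 1 w)) := by
    rw [lowerHighest', hA.C_D hq hw he]; abel
  have hT' : A 2 1 (A 1 0 w) = lowerHighest' q A n w +
      (qNum q n / qNum q (n + 1)) • A 1 0 (A 2 1 w) := by
    rw [lowerHighest']; abel
  have hB : A 1 2 (A 2 1 w) = lowerHighest q A (n + 1) (A 2 1 w) +
      (qNum q (n + 1 + 1))⁻¹ • A 1 0 (A 0 2 (A 2 1 w)) := by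
    rw [lowerHighest]; abel
  have hDT : A 0 2 (lowerHighest' q A n w) = lowerHighest' q A (n + 1) (A 0 2 w) -
      (qNum q (n + 1))⁻¹ • lowerHighest q A (n + 1) (A 2 1 w) + qNum q (a - c) • w := by
    rw [hTD]; abel
  conv_lhs => rw [lowerHighest', hCR, lowerHighest]
  conv_rhs => rw [lowerHighest, hDT]
  simp only [map_sub, map_add, LinearMap.map_smul_of_tower, hA.comm_FB, hCB, hCFF, hT, hT',
    sub_add_cancel]
  simp only [← hA.comm_FB, hB, hA.C_D hq hw he, map_add, LinearMap.map_smul_of_tower]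
  match_scalars
  · field_simp
  · field_simp
    linear_combination hsq
  · field_simp
    linear_combination q * hr1 + qNum q (n + 1) * hqi
  · field_simp
    linear_combination -h3
  · field_simp
    linear_combination q * hr + qNum q n * hqi

end IsUqRep

end HighestVectors

/-! ### Strings under powers of F, and the family of highest vectors h(k,l). -/

section HighestFamily

variable {V : Type*} [AddCommGroup V] [Module ℂ V] {q : ℝ} {A : Fin 3 → Fin 3 → Module.End ℂ V}

theorem Module.End.pow_succ_apply (F : Module.End ℂ V) (r : ℕ) (v : V) :
    (F ^ (r + 1)) v = F ((F ^ r) v) := by rw [pow_succ', Module.End.mul_apply]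

theorem Module.End.pow_succ_apply' (F : Module.End ℂ V) (r : ℕ) (v : V) :
    (F ^ (r + 1)) v = (F ^ r) (F v) := by rw [pow_succ, Module.End.mul_apply]

namespace IsUqRep

variable (hA : IsUqRep q A) (hq : 0 < q) {a b c n : ℝ} {w : V}
  (hw : IsWeightVector A ![a, b, c] w) (he : A 0 1 w = 0)
include hA

theorem weight_F_pow (hw : IsWeightVector A ![a, b, c] w) (r : ℕ) :
    IsWeightVector A ![a - r, b + r, c] ((A 1 0 ^ r) w) := by
  induction r with
  | zero => simpa using hw
  | succ r ih =>
    rw [Module.End.pow_succ_apply]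
    exact (hA.weight_21 ih).congr (by push_cast; ring) (by push_cast; ring) rfl

theorem weight_D_pow (hw : IsWeightVector A ![a, b, c] w) (l : ℕ) :
    IsWeightVector A ![a + l, b, c - l] ((A 0 2 ^ l) w) := by
  induction l with
  | zero => simpa using hw
  | succ r ih =>
    rw [Module.End.pow_succ_apply]
    exact (hA.weight_13 ih).congr (by push_cast; ring) rfl (by push_cast; ring)

include hq

theorem E_F_pow (hw : IsWeightVector A ![a, b, c] w) (he : A 0 1 w = 0) (hn : n = a - b) (r : ℕ) :
    A 0 1 ((A 1 0 ^ (r + 1)) w) = (qNum q (r + 1) * qNum q (n - r)) • (A 1 0 ^ r) w := by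
  induction r with
  | zero =>
    have h := hA.comm_EF hw
    rw [he, map_zero, zero_add] at h
    simp [h, hn, qNum_one hq]
  | succ r ih =>
    have e : a - ((r + 1 : ℕ) : ℝ) - (b + ((r + 1 : ℕ) : ℝ)) = n - 2 * r - 2 := by
      rw [hn]; push_cast; ring
    rw [Module.End.pow_succ_apply, hA.comm_EF (hA.weight_F_pow hw (r + 1)), ih, e,
      LinearMap.map_smul_of_tower, ← Module.End.pow_succ_apply, ← add_smul]
    congr 1
    have h3 := qNum_three_term hq 1 (n - 2 * r - 2) (r + 1)
    rw [qNum_one hq, one_mul] at h3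
    have e1 : (n - 2 * r - 2) + (r + 1 : ℝ) = n - (r + 1) := by ring
    have e2 : 1 + (n - 2 * r - 2) + (r + 1 : ℝ) = n - r := by ring
    have e3 : 1 + (r + 1 : ℝ) = r + 1 + 1 := by ring
    rw [e1, e2, e3] at h3
    push_cast
    linear_combination -h3

/-- The q-Serre relation is a three-term recurrence in r with the middle coefficient [2] = q + q⁻¹,
the same one that q-numbers satisfy. -/
theorem C_F_pow (v : V) (r : ℕ) : A 2 1 ((A 1 0 ^ (r + 1)) v) =
    qNum q (r + 1) • (A 1 0 ^ r) (A 2 1 (A 1 0 v)) - qNum q r • (A 1 0 ^ (r + 1)) (A 2 1 v) := by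
  induction r generalizing v with
  | zero => simp [qNum_one hq, qNum_zero]
  | succ r ih =>
    have hr := qNum_recurrence hq (r + 1)
    rw [add_sub_cancel_right] at hr
    rw [Module.End.pow_succ_apply', ih, hA.comm_CFF]
    simp only [map_sub, LinearMap.map_smul_of_tower, ← Module.End.pow_succ_apply']
    push_cast
    match_scalars
    · rw [hr]; ring
    · ring

omit hq in
theorem B_F_pow (v : V) (r : ℕ) : A 1 2 ((A 1 0 ^ r) v) = (A 1 0 ^ r) (A 1 2 v) := by
  induction r with
  | zero => rfl
  | succ k ih => rw [Module.End.pow_succ_apply, ← hA.comm_FB, ih, Module.End.pow_succ_apply]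

theorem D_F_pow (hw : IsWeightVector A ![a, b, c] w) (hn : n = a - b) (r : ℕ) :
    A 0 2 ((A 1 0 ^ (r + 1)) w) =
      (A 1 0 ^ (r + 1)) (A 0 2 w) - (q ^ (n - r) * qNum q (r + 1)) • (A 1 0 ^ r) (A 1 2 w) := by
  induction r with
  | zero =>
    simp [hA.comm_DF hq hw, hn, qNum_one hq]
  | succ r ih =>
    have e : a - ((r + 1 : ℕ) : ℝ) - (b + ((r + 1 : ℕ) : ℝ)) = n - (r + 1) - (r + 1) := by
      rw [hn]; push_cast; ring
    rw [Module.End.pow_succ_apply, hA.comm_DF hq (hA.weight_F_pow hw (r + 1)), ih, e, map_sub,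
      LinearMap.map_smul_of_tower, ← Module.End.pow_succ_apply, ← Module.End.pow_succ_apply,
      hA.B_F_pow,
      sub_sub, ← add_smul]
    congr 2
    have h1 := qNum_add hq ((r : ℝ) + 1) 1
    rw [qNum_one hq, Real.rpow_one] at h1
    have e1 : q ^ (n - r) = q ^ (n - (r + 1)) * q := by
      rw [← Real.rpow_add_one hq.ne']; congr 1; ring
    have e2 : q ^ (n - (r + 1) - (r + 1)) = q ^ (n - (r + 1)) * q ^ (-((r : ℝ) + 1)) := by
      rw [← Real.rpow_add hq]; congr 1
    push_cast
    rw [h1, e1, e2]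
    ring

omit hq in
theorem B_F_pow_highest (w : V) (n : ℝ) (r : ℕ) : A 1 2 ((A 1 0 ^ r) w) =
    (A 1 0 ^ r) (lowerHighest q A n w) +
      (qNum q (n + 1))⁻¹ • (A 1 0 ^ (r + 1)) (A 0 2 w) := by
  rw [hA.B_F_pow, lowerHighest, map_sub, LinearMap.map_smul_of_tower,
    ← Module.End.pow_succ_apply', sub_add_cancel]

/-- This splits D F^r w into its components of spin (n+1)/2 and (n-1)/2. At r = 0 the truncated
exponent r - 1 is harmless since its coefficient contains [r]; the same convention is used for C
below. -/
theorem D_F_pow_highest (hw : IsWeightVector A ![a, b, c] w) (hn : n = a - b) (h1 : 0 < n + 1)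
    (r : ℕ) : A 0 2 ((A 1 0 ^ r) w) =
      (q ^ (-r : ℝ) * qNum q (n + 1 - r) / qNum q (n + 1)) • (A 1 0 ^ r) (A 0 2 w) -
      (q ^ (n - r + 1) * qNum q r) • (A 1 0 ^ (r - 1)) (lowerHighest q A n w) := by
  have hne := (qNum_pos hq h1).ne'
  cases r with
  | zero => simp [qNum_zero, div_self hne]
  | succ r =>
    have e : n - ((r + 1 : ℕ) : ℝ) + 1 = n - r := by push_cast; ring
    rw [hA.D_F_pow hq hw hn, Nat.add_sub_cancel, e, lowerHighest]
    have h := qNum_add hq (r + 1) (n - r)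
    have e2 : (r : ℝ) + 1 + (n - r) = n + 1 := by ring
    have e3 : n + 1 - ((r + 1 : ℕ) : ℝ) = n - r := by push_cast; ring
    rw [e2] at h
    rw [e3, map_sub, LinearMap.map_smul_of_tower, ← Module.End.pow_succ_apply']
    push_cast
    match_scalars
    · field_simp
      linear_combination h
    · ring

omit hA hq in
theorem F_C_eq (w : V) (n : ℝ) : A 2 1 (A 1 0 w) = lowerHighest' q A n w +
    (qNum q n / qNum q (n + 1)) • A 1 0 (A 2 1 w) := by
  rw [lowerHighest']; abel

theorem C_F_pow_highest (w : V) (h1 : 0 < n + 1) (r : ℕ) : A 2 1 ((A 1 0 ^ r) w) =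
    qNum q r • (A 1 0 ^ (r - 1)) (lowerHighest' q A n w) +
      (qNum q (n - r + 1) / qNum q (n + 1)) • (A 1 0 ^ r) (A 2 1 w) := by
  have hne := (qNum_pos hq h1).ne'
  cases r with
  | zero => simp [qNum_zero, div_self hne]
  | succ r =>
    have e : n - ((r + 1 : ℕ) : ℝ) + 1 = n - r := by push_cast; ring
    rw [hA.C_F_pow hq, Nat.add_sub_cancel, e, F_C_eq w n, map_add, LinearMap.map_smul_of_tower,
      ← Module.End.pow_succ_apply']
    have h7 := qNum_three_term hq r (-n - 1) 1
    have e8 : (r : ℝ) + (-n - 1) + 1 = -(n - r) := by ring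
    have e9 : -n - 1 + 1 = -n := by ring
    have e10 : -n - 1 = -(n + 1) := by ring
    rw [e8, e9, e10, qNum_neg, qNum_neg, qNum_neg, qNum_one hq] at h7
    push_cast
    match_scalars
    · ring
    · field_simp
      linear_combination -h7

theorem G_F_pow_highest (w : V) (h1 : 0 < n + 1) (r : ℕ) : A 2 0 ((A 1 0 ^ r) w) =
    q ^ (r : ℝ) • (A 1 0 ^ r) (lowerHighest' q A n w) -
      (q ^ (-(n - r + 1)) / qNum q (n + 1)) • (A 1 0 ^ (r + 1)) (A 2 1 w) := by
  have hne := (qNum_pos hq h1).ne'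
  have hq' := hq.ne'
  have e : n - ((r + 1 : ℕ) : ℝ) + 1 = n - r := by push_cast; ring
  have h2 := rpow_eq_qNum hq (r + 1)
  have h3 := rpow_neg_eq_qNum hq (n - r)
  have e2 : q ^ (r + 1 : ℝ) = q ^ (r : ℝ) * q := by rw [Real.rpow_add hq, Real.rpow_one]
  have e3 : q ^ (-(n - r)) = q ^ (-(n - r + 1)) * q := by
    rw [← Real.rpow_add_one hq.ne']; congr 1; ring
  rw [add_sub_cancel_right, e2] at h2
  rw [e3] at h3
  rw [hA.G_apply, ← Module.End.pow_succ_apply, hA.C_F_pow_highest hq w h1,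
    hA.C_F_pow_highest hq w h1, map_add, LinearMap.map_smul_of_tower,
    LinearMap.map_smul_of_tower, ← Module.End.pow_succ_apply, Nat.add_sub_cancel, e]
  cases r with
  | zero =>
    simp only [Nat.cast_zero, qNum_zero, zero_smul, zero_add, Nat.cast_one, qNum_one hq,
      sub_zero, Real.rpow_zero, pow_one, pow_zero, Module.End.one_apply] at h3 ⊢
    match_scalars
    · field_simp
    · field_simp
      linear_combination h3
  | succ r =>
    rw [Nat.add_sub_cancel, ← Module.End.pow_succ_apply]
    push_cast at *
    match_scalars
    · field_simp
      linear_combination -h2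
    · field_simp
      linear_combination h3

end IsUqRep

theorem lowerHighest_smul (n x : ℝ) (w : V) :
    lowerHighest q A n (x • w) = x • lowerHighest q A n w := by
  simp only [lowerHighest, LinearMap.map_smul_of_tower, smul_sub, smul_comm x]

theorem lowerHighest'_smul (n x : ℝ) (w : V) :
    lowerHighest' q A n (x • w) = x • lowerHighest' q A n w := by
  simp only [lowerHighest', LinearMap.map_smul_of_tower, smul_sub, smul_comm x]

/-- The `U`-highest vectors obtained from a lowest weight vector `L` by applying `A₁₃` `l` times
and then `k` times the `U`-spin lowering component of `A₂₃`; here `s = m₁ - m₂` on `L`. -/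
noncomputable def highestVec (q : ℝ) (A : Fin 3 → Fin 3 → Module.End ℂ V) (s : ℝ) (L : V) :
    ℕ → ℕ → V
  | 0, l => (A 0 2 ^ l) L
  | k + 1, l => lowerHighest q A (s - k + l) (highestVec q A s L k l)

namespace IsUqRep

variable (hA : IsUqRep q A) (hq : 0 < q) {a b c : ℝ} {L : V}
  (hL : IsWeightVector A ![a, b, c] L) (he : A 0 1 L = 0)
include hA

theorem weight_highestVec (hL : IsWeightVector A ![a, b, c] L) (s : ℝ) (k l : ℕ) :
    IsWeightVector A ![a + l, b + k, c - k - l] (highestVec q A s L k l) := by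
  induction k with
  | zero => exact (hA.weight_D_pow hL l).congr rfl (by simp) (by simp)
  | succ k ih =>
    exact (hA.weight_lowerHighest ih _).congr rfl (by push_cast; ring) (by push_cast; ring)

include hq hL he

/-- The bound reaches one step past the range of k, to a - b + 1: being killed by E is needed for
that extra vector in order to compute that its norm is zero. -/
theorem raise_highestVec (k l : ℕ) (hk : (k : ℝ) ≤ a - b + 1) :
    A 0 1 (highestVec q A (a - b) L k l) = 0 := by
  induction k with
  | zero =>
    induction l with
    | zero => exact he
    | succ l ih =>
      have := hA.raise_D hq ih
      rwa [highestVec, Module.End.pow_succ_apply]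
  | succ k ih =>
    push_cast at hk
    have hl : (0 : ℝ) ≤ l := l.cast_nonneg
    exact hA.raise_lowerHighest hq (hA.weight_highestVec hL _ k l) (ih (by linarith)) (by ring)
      (by linarith)

omit he in
-- Each passage of D through an R contributes [n+2]/[n+1], where n drops by one from factor to
-- factor, so the product telescopes.
theorem D_highestVec (k l : ℕ) (hk : (k : ℝ) ≤ a - b + 1) :
    A 0 2 (highestVec q A (a - b) L k l) =
      (qNum q (a - b + l + 2) / qNum q (a - b - k + l + 2)) •
        highestVec q A (a - b) L k (l + 1) := by
  have hl : (0 : ℝ) ≤ l := l.cast_nonneg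
  induction k with
  | zero =>
    have := (qNum_pos hq (show 0 < a - b + l + 2 by push_cast at hk; linarith)).ne'
    simp [highestVec, Module.End.pow_succ_apply, div_self this]
  | succ k ih =>
    push_cast at hk
    have h1 := (qNum_pos hq (show 0 < a - b - k + l + 1 by linarith)).ne'
    have h2 := (qNum_pos hq (show 0 < a - b - k + l + 2 by linarith)).ne'
    have e : a - b - ((k + 1 : ℕ) : ℝ) + l + 2 = a - b - k + l + 1 := by push_cast; ring
    have e2 : a - b - k + ((l + 1 : ℕ) : ℝ) = a - b - k + l + 1 := by push_cast; ring
    rw [highestVec, hA.D_lowerHighest hq (hA.weight_highestVec hL _ k l) (by ring) (by linarith),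
      ih (by linarith), highestVec, e, e2, lowerHighest, lowerHighest]
    simp only [LinearMap.map_smul_of_tower]
    match_scalars <;> field_simp

variable (hC : A 2 1 L = 0) (hCF : A 2 1 (A 1 0 L) = 0)
include hC hCF

omit hCF in
theorem C_highestVec_zero (l : ℕ) (h : 0 ≤ a - b) :
    A 2 1 (highestVec q A (a - b) L 0 l) = 0 := by
  induction l with
  | zero => exact hC
  | succ l ih =>
    have hE := hA.raise_highestVec hq hL he 0 l (by push_cast; linarith)
    have h := hA.C_D hq (hA.weight_highestVec hL _ 0 l) hE
    rw [ih, map_zero] at h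
    rwa [highestVec, Module.End.pow_succ_apply]

/-- Moving T past one D adds [a - c + 2l], since the term with C vanishes at k = 0. The sum closes
because [l][a-c+l-1] + [a-c+2l] = [l+1][a-c+l]. -/
theorem lowerHighest'_highestVec_zero (l : ℕ) (h : 0 ≤ a - b) :
    lowerHighest' q A (a - b + l) (highestVec q A (a - b) L 0 l) =
      -((qNum q l * qNum q (a - c + l - 1)) • highestVec q A (a - b) L 0 (l - 1)) := by
  induction l with
  | zero => simp [lowerHighest', highestVec, hCF, hC, qNum_zero]
  | succ l ih =>
    have hl : (0 : ℝ) ≤ l := l.cast_nonneg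
    have hE := hA.raise_highestVec hq hL he 0 l (by push_cast; linarith)
    have hT := hA.lowerHighest'_D hq (hA.weight_highestVec hL _ 0 l) hE (n := a - b + l)
      (by push_cast; ring) (by linarith)
    have e1 : a - b + ((l + 1 : ℕ) : ℝ) = a - b + l + 1 := by push_cast; ring
    have e2 : highestVec q A (a - b) L 0 (l + 1) = A 0 2 (highestVec q A (a - b) L 0 l) :=
      Module.End.pow_succ_apply _ _ _
    have e3 : a + l - (c - ((0 : ℕ) : ℝ) - l) = a - c + 2 * l := by push_cast; ring
    have h3 := qNum_three_term hq l (a - c + l - 1) 1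
    have e4 : (l : ℝ) + (a - c + l - 1) + 1 = a - c + 2 * l := by ring
    have e5 : a - c + l - 1 + 1 = a - c + l := by ring
    have e6 : a - c + ((l + 1 : ℕ) : ℝ) - 1 = a - c + l := by push_cast; ring
    have hD : (qNum q l * qNum q (a - c + l - 1)) • A 0 2 (highestVec q A (a - b) L 0 (l - 1)) =
        (qNum q l * qNum q (a - c + l - 1)) • highestVec q A (a - b) L 0 l := by
      cases l with
      | zero => simp [qNum_zero]
      | succ l =>
        congr 1
        exact (Module.End.pow_succ_apply _ _ _).symm
    rw [e4, e5, qNum_one hq, one_mul] at h3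
    rw [hA.C_highestVec_zero hq hL he hC l h, ih, map_neg, LinearMap.map_smul_of_tower, hD, e3,
      ← h3] at hT
    rw [e1, e2, hT, e6, Nat.add_sub_cancel, lowerHighest]
    simp only [map_zero, smul_zero, sub_zero, add_zero]
    push_cast
    module

/-- T commutes with R, so the coefficient found at k = 0 persists for all k. -/
theorem lowerHighest'_highestVec (k l : ℕ) (hk : (k : ℝ) ≤ a - b) :
    lowerHighest' q A (a - b - k + l) (highestVec q A (a - b) L k l) =
      -((qNum q l * qNum q (a - c + l - 1)) • highestVec q A (a - b) L k (l - 1)) := by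
  induction k with
  | zero =>
    have := hA.lowerHighest'_highestVec_zero hq hL he hC hCF l (by simpa using hk)
    simpa using this
  | succ k ih =>
    push_cast at hk
    have hl : (0 : ℝ) ≤ l := l.cast_nonneg
    have hE := hA.raise_highestVec hq hL he k l (by linarith)
    have hT := hA.lowerHighest'_lowerHighest hq (hA.weight_highestVec hL _ k l) hE
      (n := a - b - k + l) (by ring) (by linarith)
    have e : a - b - ((k + 1 : ℕ) : ℝ) + l = a - b - k + l - 1 := by push_cast; ring
    rw [highestVec, e, hT, ih (by linarith), ← neg_smul, lowerHighest_smul, neg_smul]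
    congr 1
    cases l with
    | zero => simp [qNum_zero]
    | succ l =>
      have e : a - b - k + ((l + 1 : ℕ) : ℝ) - 1 = a - b - k + l := by push_cast; ring
      rw [e]
      rfl

/-- Induction on k through `lowerHighest_C`: the term T D h(k,l) is already known as a multiple of
h(k,l), and the remaining scalar identity is `qNum_norm_recursion`. -/
theorem C_highestVec (k l : ℕ) (hk : (k : ℝ) ≤ a - b + 1) (h : 0 ≤ a - b) :
    A 2 1 (highestVec q A (a - b) L k l) =
      -((qNum q k * qNum q (b - c + k - 2) * qNum q (a - b - k + 1) /
        qNum q (a - b - k + l + 2)) • highestVec q A (a - b) L (k - 1) l) := by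
  induction k with
  | zero => simp [hA.C_highestVec_zero hq hL he hC l h, qNum_zero]
  | succ k ih =>
    push_cast at hk
    have hl : (0 : ℝ) ≤ l := l.cast_nonneg
    have hE := hA.raise_highestVec hq hL he k l (by linarith)
    have h1 := (qNum_pos hq (show 0 < a - b - k + l + 1 by linarith)).ne'
    have h2 := (qNum_pos hq (show 0 < a - b - k + l + 2 by linarith)).ne'
    have hCR := hA.lowerHighest_C hq (hA.weight_highestVec hL (a - b) k l) hE
      (n := a - b - k + l) (by linarith)
    have hT := hA.lowerHighest'_highestVec hq hL he hC hCF k (l + 1) (by linarith)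
    have e1 : a - b - k + ((l + 1 : ℕ) : ℝ) = a - b - k + l + 1 := by push_cast; ring
    have e2 : a - c + ((l + 1 : ℕ) : ℝ) - 1 = a - c + l := by push_cast; ring
    have e3 : b + k - (c - k - l) = b - c + 2 * k + l := by ring
    have e4 : b - c + ((k + 1 : ℕ) : ℝ) - 2 = b - c + k - 1 := by push_cast; ring
    have e5 : a - b - ((k + 1 : ℕ) : ℝ) + 1 = a - b - k := by push_cast; ring
    have e6 : a - b - ((k + 1 : ℕ) : ℝ) + l + 2 = a - b - k + l + 1 := by push_cast; ring
    -- Applying R to h(k-1,l) restores h(k,l) when k > 0; when k = 0 the factor [k] makes the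
    -- truncated index irrelevant.
    have hR : (qNum q k * qNum q (b - c + k - 2) * qNum q (a - b - k + 1) /
        qNum q (a - b - k + l + 2)) • lowerHighest q A (a - b - k + l + 1)
          (highestVec q A (a - b) L (k - 1) l) =
        (qNum q k * qNum q (b - c + k - 2) * qNum q (a - b - k + 1) /
        qNum q (a - b - k + l + 2)) • highestVec q A (a - b) L k l := by
      cases k with
      | zero => simp [qNum_zero]
      | succ k =>
        have e : a - b - ((k + 1 : ℕ) : ℝ) + l + 1 = a - b - k + l := by push_cast; ring
        rw [e]
        rfl
    have hrec := qNum_norm_recursion hq k (b - c) (a - b) l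
    have e7 : a - b + (b - c) + l = a - c + l := by ring
    rw [e7] at hrec
    rw [ih (by linarith), hA.D_highestVec hq hL k l (by linarith), lowerHighest'_smul, ← e1, hT,
      e1, e2, e3, ← neg_smul, lowerHighest_smul, neg_smul, hR, Nat.add_sub_cancel] at hCR
    rw [highestVec, hCR, Nat.add_sub_cancel, e4, e5, e6]
    push_cast
    generalize qNum q (b - c + 2 * k + l) = x at hrec
    match_scalars
    field_simp
    linear_combination hrec

end IsUqRep

end HighestFamily

/-! ### The projection P^U and the reduction of B^k D^l L to h(k,l). -/

section Projection

theorem qFactorial_zero (q : ℝ) : qFactorial q 0 = 1 := by simp [qFactorial]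

theorem qFactorial_succ (q : ℝ) (n : ℕ) :
    qFactorial q (n + 1) = qFactorial q n * qNum q (n + 1) := by
  rw [qFactorial, Finset.prod_range_succ, qFactorial]

theorem qFactorial_pos {q : ℝ} (hq : 0 < q) (n : ℕ) : 0 < qFactorial q n :=
  Finset.prod_pos fun i _ => qNum_pos hq (by positivity)

/-- The coefficients of the projection operator `projU`. -/
noncomputable def projCoeff (q : ℝ) (n s : ℕ) : ℝ :=
  (-1) ^ s * qFactorial q (n + 1) / (qFactorial q s * qFactorial q (n + s + 1))

theorem projCoeff_zero {q : ℝ} (hq : 0 < q) (n : ℕ) : projCoeff q n 0 = 1 := by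
  have := (qFactorial_pos hq (n + 1)).ne'
  simp [projCoeff, qFactorial_zero, div_self this]

/-- The factor [s+1][n+2+s] is the one produced by moving E^(s+1) past F on a vector with m₁ - m₂ =
n + 2. This match makes the series for P^U F telescope. -/
theorem projCoeff_succ {q : ℝ} (hq : 0 < q) (n s : ℕ) :
    projCoeff q n (s + 1) * (qNum q (s + 1) * qNum q (n + 2 + s)) = -projCoeff q n s := by
  have h1 := (qFactorial_pos hq s).ne'
  have h2 := (qFactorial_pos hq (n + s + 1)).ne'
  have h3 := (qNum_pos hq (show (0 : ℝ) < s + 1 by positivity)).ne'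
  have h4 := (qNum_pos hq (show (0 : ℝ) < n + 2 + s by positivity)).ne'
  have e : ((n + s + 1 : ℕ) : ℝ) + 1 = n + 2 + s := by push_cast; ring
  rw [projCoeff, projCoeff, ← add_assoc n s 1, qFactorial_succ q (n + s + 1), qFactorial_succ q s,
    pow_succ, e]
  field_simp

variable {V : Type*} [AddCommGroup V] [Module ℂ V] {q : ℝ} {A : Fin 3 → Fin 3 → Module.End ℂ V}

namespace IsUqRep

variable (hA : IsUqRep q A) (hq : 0 < q) {a b c n : ℝ} {w y : V}
include hA

theorem weight_E_pow (hw : IsWeightVector A ![a, b, c] w) (r : ℕ) :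
    IsWeightVector A ![a + r, b - r, c] ((A 0 1 ^ r) w) := by
  induction r with
  | zero => simpa using hw
  | succ r ih =>
    rw [Module.End.pow_succ_apply]
    exact (hA.weight_12 ih).congr (by push_cast; ring) (by push_cast; ring) rfl

include hq

theorem E_pow_F (hy : IsWeightVector A ![a, b, c] y) (hn : n = a - b) (s : ℕ) :
    (A 0 1 ^ (s + 1)) (A 1 0 y) = A 1 0 ((A 0 1 ^ (s + 1)) y) +
      (qNum q (s + 1) * qNum q (n + s)) • (A 0 1 ^ s) y := by
  induction s with
  | zero => simp [hA.comm_EF hy, hn, qNum_one hq]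
  | succ s ih =>
    have e : a + ((s + 1 : ℕ) : ℝ) - (b - ((s + 1 : ℕ) : ℝ)) = s + 1 + (n + s) + 1 := by
      rw [hn]; push_cast; ring
    have h := qNum_three_term hq (s + 1) (n + s) 1
    rw [qNum_one hq, one_mul] at h
    rw [Module.End.pow_succ_apply, ih, map_add, LinearMap.map_smul_of_tower,
      hA.comm_EF (hA.weight_E_pow hy _), e, ← Module.End.pow_succ_apply,
      ← Module.End.pow_succ_apply]
    push_cast
    rw [← add_assoc n, ← h]
    module

/-- The annihilation of the image of `A₂₁` by `P^U`, on vectors on which the sum is finite. -/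
theorem projU_add_F (n : ℕ)
    (he : A 0 1 w = 0) (hy : IsWeightVector A ![a, b, c] y) (hn : n + 2 = a - b) (k : ℕ)
    (hk : (A 0 1 ^ k) y = 0) :
    ∑ᶠ s : ℕ, (((-1) ^ s * qFactorial q (n + 1) /
      (qFactorial q s * qFactorial q (n + s + 1)) : ℝ) : ℂ) •
        (A 1 0 ^ s) ((A 0 1 ^ s) (w + A 1 0 y)) = w := by
  set u : ℕ → V := fun s => projCoeff q n s • (A 1 0 ^ (s + 1)) ((A 0 1 ^ s) y) with hu
  have hkill : ∀ s, k ≤ s → u s = 0 := by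
    intro s hs
    obtain ⟨d, rfl⟩ := Nat.exists_eq_add_of_le hs
    rw [hu]
    simp only
    rw [add_comm k d, pow_add (A 0 1) d k, Module.End.mul_apply, hk]
    simp
  set t : ℕ → V := fun s => projCoeff q n s • (A 1 0 ^ s) ((A 0 1 ^ s) (w + A 1 0 y)) with ht
  have h0 : t 0 = w + u 0 := by simp [ht, hu, projCoeff_zero hq]
  -- Telescoping: E^(s+1) F y yields F E^(s+1) y plus a multiple of E^s y, and by the choice of the
  -- coefficients the second part cancels the previous summand. Partial sums are w + u N, and u N
  -- vanishes once E^N kills y.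
  have hsucc : ∀ s, t (s + 1) = u (s + 1) - u s := by
    intro s
    have hw : (A 0 1 ^ (s + 1)) w = 0 := by rw [Module.End.pow_succ_apply', he, map_zero]
    simp only [ht, hu]
    rw [map_add, hw, zero_add, hA.E_pow_F hq hy hn, map_add, ← Module.End.pow_succ_apply',
      LinearMap.map_smul_of_tower, smul_add, smul_smul, projCoeff_succ hq, neg_smul,
      sub_eq_add_neg]
  have hsum : ∀ N, ∑ s ∈ Finset.range (N + 1), t s = w + u N := by
    intro N
    induction N with
    | zero => simp [h0]
    | succ N ih => rw [Finset.sum_range_succ, ih, hsucc]; abel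
  have hfin : ∑ᶠ s, t s = ∑ s ∈ Finset.range (k + 1), t s := by
    apply finsum_eq_sum_of_support_subset
    intro s hs
    by_contra hns
    apply hs
    simp only [Finset.coe_range, Set.mem_Iio, not_lt] at hns
    obtain ⟨d, rfl⟩ := Nat.exists_eq_add_of_le hns
    rw [show k + 1 + d = k + d + 1 by ring, hsucc, hkill _ (by omega), hkill _ (by omega), sub_zero]
  calc _ = ∑ᶠ s, t s := rfl
    _ = w := by rw [hfin, hsum, hkill k le_rfl, add_zero]

omit hq in
-- The value of x does not matter: the identity serves only to show that if E^N kills a vector v,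
-- then E^(N+1) kills B v.
theorem E_pow_B (hq : 0 < q) (N : ℕ) : ∃ x : ℝ, ∀ v : V, (A 0 1 ^ (N + 1)) (A 1 2 v) =
    q ^ (N + 1) • A 1 2 ((A 0 1 ^ (N + 1)) v) + x • A 0 2 ((A 0 1 ^ N) v) := by
  induction N with
  | zero => exact ⟨1, fun v => by simp [hA.EB_apply, add_comm]⟩
  | succ N ih =>
    obtain ⟨x, hx⟩ := ih
    refine ⟨q ^ (N + 1) + q⁻¹ * x, fun v => ?_⟩
    rw [Module.End.pow_succ_apply, hx, map_add, LinearMap.map_smul_of_tower,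
      LinearMap.map_smul_of_tower, hA.EB_apply, hA.comm_ED hq, ← Module.End.pow_succ_apply,
      ← Module.End.pow_succ_apply]
    module

/-- Modulo the image of F, B agrees with R on highest vectors, and B preserves this image since it
commutes with F. The weight of y and E^k y = 0 are recorded because `projU_add_F` needs them. -/
theorem B_pow_D_pow {L : V} (hL : IsWeightVector A ![a, b, c] L) (he : A 0 1 L = 0) (k l : ℕ)
    (hk : (k : ℝ) ≤ a - b + 1) :
    ∃ y, IsWeightVector A ![a + l + 1, b + k - 1, c - k - l] y ∧ (A 0 1 ^ k) y = 0 ∧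
      (A 1 2 ^ k) ((A 0 2 ^ l) L) = highestVec q A (a - b) L k l + A 1 0 y := by
  induction k with
  | zero => exact ⟨0, fun i => by simp, by simp, by simp [highestVec]⟩
  | succ k ih =>
    push_cast at hk
    obtain ⟨y, hy, hEy, h⟩ := ih (by linarith)
    have hD := hA.weight_13 (hA.weight_highestVec hL (a - b) k l)
    have hED := hA.raise_D hq (hA.raise_highestVec hq hL he k l (by linarith))
    obtain ⟨x, hx⟩ := hA.E_pow_B hq k
    -- From B (h + F y) = R h + F ([n+1]⁻¹ D h + B y), with n = a - b - k + l.
    refine ⟨(qNum q (a - b - k + l + 1))⁻¹ • A 0 2 (highestVec q A (a - b) L k l) + A 1 2 y,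
      ?_, ?_, ?_⟩
    · exact ((hD.smul _).congr (by ring) (by push_cast; ring) (by push_cast; ring)).add
        ((hA.weight_23 hy).congr (by ring) (by push_cast; ring) (by push_cast; ring))
    · rw [map_add, LinearMap.map_smul_of_tower, Module.End.pow_succ_apply', hED, map_zero,
        smul_zero, zero_add, hx, Module.End.pow_succ_apply, hEy]
      simp
    · rw [Module.End.pow_succ_apply, h, map_add, highestVec, lowerHighest, map_add,
        LinearMap.map_smul_of_tower, hA.comm_FB]
      abel

end IsUqRep

end Projection

/-! ### The vectors P^U B^k D^l L are the h(k,l). -/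

section UHighest

variable {V : Type*} [NormedAddCommGroup V] [InnerProductSpace ℂ V] {q : ℝ} {f : Fin 3 → ℤ}
  {A : Fin 3 → Fin 3 → Module.End ℂ V} {L : V}

theorem ULabel.twoU_cast (x : ULabel f) : (x.twoU : ℝ) = (f 0 : ℝ) - f 1 - x.k + x.l := by
  have h := x.hk
  have : ((x.twoU : ℕ) : ℤ) = f 0 - f 1 - x.k + x.l := by
    rw [ULabel.twoU, Int.toNat_of_nonneg]; omega
  exact_mod_cast congrArg (Int.cast : ℤ → ℝ) this

theorem IsUqRep.uHighest_eq (hA : IsUqRep q A) (hq : 0 < q)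
    (hL : IsWeightVector A ![(f 0 : ℝ), f 1, f 2] L) (he : A 0 1 L = 0) (x : ULabel f) :
    uHighest q A L x = highestVec q A ((f 0 : ℝ) - f 1) L x.k x.l := by
  have hk : (x.k : ℝ) ≤ (f 0 : ℝ) - f 1 := by exact_mod_cast x.hk
  have hk' : (x.k : ℝ) ≤ (f 0 : ℝ) - f 1 + 1 := by linarith
  obtain ⟨y, hy, hEy, h⟩ := hA.B_pow_D_pow hq hL he x.k x.l hk'
  rw [uHighest, h, projU]
  exact hA.projU_add_F hq x.twoU (hA.raise_highestVec hq hL he x.k x.l hk') hy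
    (by rw [x.twoU_cast]; ring) x.k hEy

end UHighest

/-! ### Norms of highest vectors from Hermitian conjugation. -/

section Unitary

variable {V : Type*} [NormedAddCommGroup V] [InnerProductSpace ℂ V] {q : ℝ}
  {A : Fin 3 → Fin 3 → Module.End ℂ V}

namespace IsU21Unitary

variable (hU : IsU21Unitary A)
include hU

theorem adj_21 (x y : V) : inner ℂ (A 1 0 x) y = inner ℂ x (A 0 1 y) := by
  rw [← inner_conj_symm, ← hU.adj_12, inner_conj_symm]

theorem adj_21_pow (r : ℕ) (x y : V) :
    inner ℂ ((A 1 0 ^ r) x) y = inner ℂ x ((A 0 1 ^ r) y) := by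
  induction r generalizing y with
  | zero => rfl
  | succ r ih =>
    rw [Module.End.pow_succ_apply, hU.adj_21, ih, Module.End.pow_succ_apply']

theorem inner_eq_zero_of_weight_ne {m m' : Fin 3 → ℝ} {x y : V} (hx : IsWeightVector A m x)
    (hy : IsWeightVector A m' y) {i : Fin 3} (h : m i ≠ m' i) : inner ℂ x y = 0 := by
  have h1 := hU.adj_diag i x y
  rw [hx i, hy i, inner_smul_left, inner_smul_right, Complex.conj_ofReal, ← sub_eq_zero,
    ← sub_mul] at h1
  refine (mul_eq_zero.1 h1).resolve_left ?_
  exact sub_ne_zero.2 (by exact_mod_cast h)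

end IsU21Unitary

theorem norm_sq_eq_of_inner {x y : V} {t : ℝ} (h : inner ℂ x x = (t : ℂ) * inner ℂ y y) :
    ‖x‖ ^ 2 = t * ‖y‖ ^ 2 := by
  rw [inner_self_eq_norm_sq_to_K, inner_self_eq_norm_sq_to_K] at h
  apply Complex.ofReal_injective
  push_cast
  exact h

namespace IsUqRep

variable (hA : IsUqRep q A) (hU : IsU21Unitary A) (hq : 0 < q) {a b c n t : ℝ} {w : V}
include hA hU

omit hA in
-- The correction term of R lies in the image of F, which is orthogonal to vectors killed by E.
-- Against such vectors only B counts, so the adjoint of R is -C.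
theorem norm_sq_lowerHighest (hR : A 0 1 (lowerHighest q A n w) = 0)
    (hC : A 2 1 (lowerHighest q A n w) = -(t • w)) :
    ‖lowerHighest q A n w‖ ^ 2 = t * ‖w‖ ^ 2 := by
  apply norm_sq_eq_of_inner
  have h : ∀ y, A 0 1 y = 0 → inner ℂ (lowerHighest q A n w) y = -inner ℂ w (A 2 1 y) := by
    intro y hy
    rw [lowerHighest, ← Complex.coe_smul, inner_sub_left, inner_smul_left, hU.adj_23, hU.adj_21,
      hy, inner_zero_right, mul_zero, sub_zero]
  rw [h _ hR, hC, inner_neg_right, neg_neg, ← Complex.coe_smul, inner_smul_right]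

/-- Since E w = 0, D w = E B w, so the adjoint of D at w is -C F. Modulo the image of F, which is
orthogonal to w, C F is T. -/
theorem norm_sq_D (he : A 0 1 w = 0) (hT : lowerHighest' q A n (A 0 2 w) = -(t • w)) :
    ‖A 0 2 w‖ ^ 2 = t * ‖w‖ ^ 2 := by
  apply norm_sq_eq_of_inner
  have h : A 0 2 w = A 0 1 (A 1 2 w) := by rw [hA.EB_apply, he, map_zero, smul_zero, add_zero]
  have h1 : inner ℂ (A 0 2 w) (A 0 2 w) = -inner ℂ w (A 2 1 (A 1 0 (A 0 2 w))) := by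
    conv_lhs => rw [h]
    rw [hU.adj_12, hU.adj_23, ← h]
  have h2 : ∀ y, inner ℂ w (A 1 0 y) = 0 := fun y => by
    rw [← hU.adj_12, he, inner_zero_left]
  rw [h1, F_C_eq _ n, hT, inner_add_right, ← Complex.coe_smul, ← Complex.coe_smul,
    inner_smul_right _ _ ((_ : ℝ) : ℂ), h2, inner_neg_right, inner_smul_right]
  simp

include hq

theorem norm_sq_F_pow (hw : IsWeightVector A ![a, b, c] w) (he : A 0 1 w = 0) (hn : n = a - b)
    (r : ℕ) : ‖(A 1 0 ^ (r + 1)) w‖ ^ 2 =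
      qNum q (r + 1) * qNum q (n - r) * ‖(A 1 0 ^ r) w‖ ^ 2 := by
  apply norm_sq_eq_of_inner
  conv_lhs => rw [Module.End.pow_succ_apply, hU.adj_21, ← Module.End.pow_succ_apply,
    hA.E_F_pow hq hw he hn, ← Complex.coe_smul, inner_smul_right]

omit hU in
theorem E_pow_F_pow (hw : IsWeightVector A ![a, b, c] w) (he : A 0 1 w = 0) {r t : ℕ}
    (h : r < t) : (A 0 1 ^ t) ((A 1 0 ^ r) w) = 0 := by
  obtain ⟨t, rfl⟩ := Nat.exists_eq_succ_of_ne_zero (Nat.ne_zero_of_lt h)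
  induction r generalizing t with
  | zero => rw [Nat.succ_eq_add_one, Module.End.pow_succ_apply']; simp [he]
  | succ r ih =>
    obtain ⟨t, rfl⟩ := Nat.exists_eq_succ_of_ne_zero (show t ≠ 0 by omega)
    rw [Nat.succ_eq_add_one, Module.End.pow_succ_apply', hA.E_F_pow hq hw he rfl,
      LinearMap.map_smul_of_tower, ih t (by omega), smul_zero]

end IsUqRep

/-- The vector `A₂₁^r` applied to the highest vector of labels `k`, `l`. -/
noncomputable def spinVec (q : ℝ) (f : Fin 3 → ℤ) (A : Fin 3 → Fin 3 → Module.End ℂ V) (L : V)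
    (k l r : ℕ) : V :=
  (A 1 0 ^ r) (highestVec q A ((f 0 : ℝ) - f 1) L k l)

namespace IsLowestWeightUIR

variable {f : Fin 3 → ℤ} {L : V}

section

variable (hA : IsLowestWeightUIR q f A L)
include hA

theorem weight' : IsWeightVector A ![(f 0 : ℝ), f 1, f 2] L := by
  convert hA.weight using 1
  ext i; fin_cases i <;> rfl

theorem lower_32_21 : A 2 1 (A 1 0 L) = 0 := by
  have h := hA.lower_31
  rwa [hA.rep.G_apply, hA.lower_32, map_zero, smul_zero, sub_zero] at h

theorem weight_spinVec (k l r : ℕ) :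
    IsWeightVector A ![f 0 + l - r, f 1 + k + r, f 2 - k - l] (spinVec q f A L k l r) :=
  hA.rep.weight_F_pow (hA.rep.weight_highestVec hA.weight' _ k l) r

end

variable (hA : IsLowestWeightUIR q f A L) (hq : 0 < q) {k l r : ℕ}
include hA hq

theorem E_highest (hk : (k : ℤ) ≤ f 0 - f 1 + 1) :
    A 0 1 (highestVec q A ((f 0 : ℝ) - f 1) L k l) = 0 :=
  hA.rep.raise_highestVec hq hA.weight' hA.raise_12 k l (by exact_mod_cast hk)

theorem D_highest (hk : (k : ℤ) ≤ f 0 - f 1 + 1) :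
    A 0 2 (highestVec q A ((f 0 : ℝ) - f 1) L k l) =
      (qNum q ((f 0 : ℝ) - f 1 + l + 2) / qNum q ((f 0 : ℝ) - f 1 - k + l + 2)) •
        highestVec q A ((f 0 : ℝ) - f 1) L k (l + 1) :=
  hA.rep.D_highestVec hq hA.weight' k l (by exact_mod_cast hk)

theorem T_highest (hk : (k : ℤ) ≤ f 0 - f 1) :
    lowerHighest' q A ((f 0 : ℝ) - f 1 - k + l) (highestVec q A ((f 0 : ℝ) - f 1) L k l) =
      -((qNum q l * qNum q ((f 0 : ℝ) - f 2 + l - 1)) •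
        highestVec q A ((f 0 : ℝ) - f 1) L k (l - 1)) :=
  hA.rep.lowerHighest'_highestVec hq hA.weight' hA.raise_12 hA.lower_32 hA.lower_32_21 k l
    (by exact_mod_cast hk)

theorem C_highest (hk : (k : ℤ) ≤ f 0 - f 1 + 1) (h : 0 ≤ f 0 - f 1) :
    A 2 1 (highestVec q A ((f 0 : ℝ) - f 1) L k l) =
      -((qNum q k * qNum q ((f 1 : ℝ) - f 2 + k - 2) * qNum q ((f 0 : ℝ) - f 1 - k + 1) /
        qNum q ((f 0 : ℝ) - f 1 - k + l + 2)) •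
          highestVec q A ((f 0 : ℝ) - f 1) L (k - 1) l) :=
  hA.rep.C_highestVec hq hA.weight' hA.raise_12 hA.lower_32 hA.lower_32_21 k l
    (by exact_mod_cast hk) (by exact_mod_cast h)

theorem norm_sq_highest_k (hk : (k : ℤ) ≤ f 0 - f 1) :
    ‖highestVec q A ((f 0 : ℝ) - f 1) L (k + 1) l‖ ^ 2 =
      qNum q (k + 1) * qNum q ((f 1 : ℝ) - f 2 + k - 1) * qNum q ((f 0 : ℝ) - f 1 - k) /
        qNum q ((f 0 : ℝ) - f 1 - k + l + 1) *
          ‖highestVec q A ((f 0 : ℝ) - f 1) L k l‖ ^ 2 := by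
  have hC := hA.C_highest hq (k := k + 1) (l := l) (by push_cast; linarith) (by omega)
  rw [Nat.add_sub_cancel] at hC
  have h := IsUqRep.norm_sq_lowerHighest hA.unitary
    (hA.E_highest hq (k := k + 1) (l := l) (by push_cast; linarith)) hC
  rw [← highestVec] at h
  have e1 : (f 1 : ℝ) - f 2 + ((k + 1 : ℕ) : ℝ) - 2 = (f 1 : ℝ) - f 2 + k - 1 := by
    push_cast; ring
  have e2 : (f 0 : ℝ) - f 1 - ((k + 1 : ℕ) : ℝ) + 1 = (f 0 : ℝ) - f 1 - k := by push_cast; ring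
  have e3 : (f 0 : ℝ) - f 1 - ((k + 1 : ℕ) : ℝ) + l + 2 = (f 0 : ℝ) - f 1 - k + l + 1 := by
    push_cast; ring
  rw [h, e1, e2, e3]
  push_cast
  rfl

theorem norm_sq_highest_l (hk : (k : ℤ) ≤ f 0 - f 1) :
    qNum q ((f 0 : ℝ) - f 1 + l + 2) / qNum q ((f 0 : ℝ) - f 1 - k + l + 2) *
      ‖highestVec q A ((f 0 : ℝ) - f 1) L k (l + 1)‖ ^ 2 =
      qNum q (l + 1) * qNum q ((f 0 : ℝ) - f 2 + l) *
          ‖highestVec q A ((f 0 : ℝ) - f 1) L k l‖ ^ 2 := by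
  have hk' : (k : ℝ) ≤ (f 0 : ℝ) - f 1 := by exact_mod_cast hk
  have hk0 : (0 : ℝ) ≤ k := k.cast_nonneg
  have hl0 : (0 : ℝ) ≤ l := l.cast_nonneg
  have hT := hA.T_highest hq (l := l + 1) hk
  rw [Nat.add_sub_cancel] at hT
  have hD := hA.D_highest hq (k := k) (l := l) (by linarith)
  set d := qNum q ((f 0 : ℝ) - f 1 + l + 2) / qNum q ((f 0 : ℝ) - f 1 - k + l + 2) with hd
  have hd0 : 0 < d := div_pos (qNum_pos hq (by linarith)) (qNum_pos hq (by linarith))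
  have h := hA.rep.norm_sq_D hA.unitary (n := (f 0 : ℝ) - f 1 - k + ((l + 1 : ℕ) : ℝ))
    (t := d * (qNum q ((l + 1 : ℕ) : ℝ) * qNum q ((f 0 : ℝ) - f 2 + ((l + 1 : ℕ) : ℝ) - 1)))
    (hA.E_highest hq (k := k) (l := l) (by linarith))
    (by rw [hD, lowerHighest'_smul, hT, smul_neg, smul_smul])
  have e : (f 0 : ℝ) - f 2 + ((l + 1 : ℕ) : ℝ) - 1 = (f 0 : ℝ) - f 2 + l := by push_cast; ring
  rw [hD, norm_smul, Real.norm_of_nonneg hd0.le, e] at h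
  push_cast at h
  -- The norm of D h(k,l) carries d², while the T-coefficient carries d, so one factor d remains.
  apply mul_left_cancel₀ hd0.ne'
  linear_combination h

end IsLowestWeightUIR

end Unitary

/-! ### The orthogonal vectors F^r h(k,l): vanishing, norms, and the action of the generators. -/

section SpinVectors

variable {V : Type*} [NormedAddCommGroup V] [InnerProductSpace ℂ V] {q : ℝ}
  {A : Fin 3 → Fin 3 → Module.End ℂ V} {f : Fin 3 → ℤ} {L : V}

namespace IsLowestWeightUIR

variable (hA : IsLowestWeightUIR q f A L) (hq : 0 < q) {k l r : ℕ}
include hA hq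

theorem norm_highest_pos (hf : IsPositiveSignature f) (hk : (k : ℤ) ≤ f 0 - f 1) :
    0 < ‖highestVec q A ((f 0 : ℝ) - f 1) L k l‖ ^ 2 := by
  obtain ⟨h1, h2, h3⟩ := hf
  have hl0 : (0 : ℝ) ≤ l := l.cast_nonneg
  have h1' : (f 1 : ℝ) ≤ f 0 := by exact_mod_cast h1
  have h2' : (1 : ℝ) ≤ f 0 - f 2 := by exact_mod_cast h2
  induction k with
  | zero =>
    induction l with
    | zero => simp [highestVec, hA.norm_one]
    | succ l ih =>
      have hl0 : (0 : ℝ) ≤ l := l.cast_nonneg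
      have h := hA.norm_sq_highest_l hq (l := l) hk
      have h4 := mul_pos (mul_pos (qNum_pos hq (show 0 < (l : ℝ) + 1 by linarith))
        (qNum_pos hq (show 0 < (f 0 : ℝ) - f 2 + l by linarith))) (ih hl0)
      rw [← h] at h4
      exact pos_of_mul_pos_right h4 (div_nonneg (qNum_nonneg hq (by linarith))
        (qNum_nonneg hq (by push_cast; linarith)))
  | succ k ih =>
    push_cast at hk
    have hk' : (k : ℝ) + 1 ≤ (f 0 : ℝ) - f 1 := by exact_mod_cast hk
    -- A step in k exists only if f₁ > f₂, so the exceptional case f₁ = f₂ of the signature does not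
    -- arise. The bound makes [f₂ - f₃ + k - 1] positive already at k = 0.
    have h3' : (2 : ℝ) ≤ f 1 - f 2 := by
      rcases h3 with h3 | h3
      · exact_mod_cast h3
      · omega
    have hk0 : (0 : ℝ) ≤ k := k.cast_nonneg
    rw [hA.norm_sq_highest_k hq (by linarith)]
    exact mul_pos (div_pos (mul_pos (mul_pos (qNum_pos hq (by linarith))
      (qNum_pos hq (by linarith))) (qNum_pos hq (by linarith))) (qNum_pos hq (by linarith)))
      (ih (by linarith))

/-- At k = f₁ - f₂ + 1 the norm recursion contains [0], and the inner product is definite; later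
vectors are images of this zero vector under R. -/
theorem highest_eq_zero (h0 : f 1 ≤ f 0) (hk : f 0 - f 1 < k) :
    highestVec q A ((f 0 : ℝ) - f 1) L k l = 0 := by
  induction k with
  | zero => push_cast at hk; omega
  | succ k ih =>
    rcases lt_or_ge (f 0 - f 1) (k : ℤ) with h | h
    · rw [highestVec, ih h]
      simp [lowerHighest]
    · have hk' : (f 0 : ℝ) - f 1 - k = 0 := by
        have : f 0 - f 1 - k = 0 := by push_cast at hk; omega
        exact_mod_cast congrArg (Int.cast : ℤ → ℝ) this
      have h := hA.norm_sq_highest_k hq (l := l) h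
      rw [hk', qNum_zero, mul_zero, zero_div, zero_mul] at h
      simpa using h

theorem norm_sq_spin_r (hk : (k : ℤ) ≤ f 0 - f 1) :
    ‖spinVec q f A L k l (r + 1)‖ ^ 2 =
      qNum q (r + 1) * qNum q ((f 0 : ℝ) - f 1 - k + l - r) * ‖spinVec q f A L k l r‖ ^ 2 :=
  hA.rep.norm_sq_F_pow hA.unitary hq (hA.rep.weight_highestVec hA.weight' _ k l)
    (hA.E_highest hq (by linarith)) (by ring) r

theorem spin_eq_zero (h0 : f 1 ≤ f 0)
    (h : ¬((k : ℤ) ≤ f 0 - f 1 ∧ (r : ℤ) ≤ f 0 - f 1 - k + l)) : spinVec q f A L k l r = 0 := by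
  rcases lt_or_ge (f 0 - f 1) (k : ℤ) with hk | hk
  · rw [spinVec, hA.highest_eq_zero hq h0 hk, map_zero]
  · induction r with
    | zero => exact absurd ⟨hk, by push_cast; omega⟩ h
    | succ r ih =>
      by_cases hr : (r : ℤ) ≤ f 0 - f 1 - k + l
      · have hr' : (f 0 : ℝ) - f 1 - k + l - r = 0 := by
          have : f 0 - f 1 - k + l - r = 0 := by push_cast at h; omega
          exact_mod_cast congrArg (Int.cast : ℤ → ℝ) this
        have h := hA.norm_sq_spin_r hq (l := l) (r := r) hk
        rw [hr', qNum_zero, mul_zero, zero_mul] at h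
        simpa using h
      · have := ih (by tauto)
        rw [spinVec] at this ⊢
        rw [Module.End.pow_succ_apply, this, map_zero]

theorem norm_sq_spin_pos (hf : IsPositiveSignature f) (hk : (k : ℤ) ≤ f 0 - f 1)
    (hr : (r : ℤ) ≤ f 0 - f 1 - k + l) : 0 < ‖spinVec q f A L k l r‖ ^ 2 := by
  induction r with
  | zero => exact hA.norm_highest_pos hq hf hk
  | succ r ih =>
    push_cast at hr
    have hr' : (r : ℝ) + 1 ≤ (f 0 : ℝ) - f 1 - k + l := by exact_mod_cast hr
    rw [hA.norm_sq_spin_r hq hk]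
    exact mul_pos (mul_pos (qNum_pos hq (by positivity)) (qNum_pos hq (by linarith)))
      (ih (by linarith))

/-- The relation is kept cross-multiplied, so that it holds for every r, including those where a
factor vanishes, and can be proved by induction on r. -/
theorem norm_sq_spin_l (hk : (k : ℤ) ≤ f 0 - f 1) :
    qNum q ((f 0 : ℝ) - f 1 - k + l + 1 - r) * (qNum q ((f 0 : ℝ) - f 1 + l + 2) /
      qNum q ((f 0 : ℝ) - f 1 - k + l + 2)) * ‖spinVec q f A L k (l + 1) r‖ ^ 2 =
      qNum q ((f 0 : ℝ) - f 1 - k + l + 1) * (qNum q (l + 1) * qNum q ((f 0 : ℝ) - f 2 + l)) *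
          ‖spinVec q f A L k l r‖ ^ 2 := by
  induction r with
  | zero =>
    have h := hA.norm_sq_highest_l hq (l := l) hk
    simp only [spinVec, pow_zero, Module.End.one_apply, Nat.cast_zero, sub_zero]
    linear_combination qNum q ((f 0 : ℝ) - f 1 - k + l + 1) * h
  | succ r ih =>
    have e : (f 0 : ℝ) - f 1 - k + ((l + 1 : ℕ) : ℝ) - r = (f 0 : ℝ) - f 1 - k + l + 1 - r := by
      push_cast; ring
    have e' : (f 0 : ℝ) - f 1 - k + l + 1 - ((r + 1 : ℕ) : ℝ) = (f 0 : ℝ) - f 1 - k + l - r := by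
      push_cast; ring
    rw [hA.norm_sq_spin_r hq hk, hA.norm_sq_spin_r hq hk, e, e']
    linear_combination qNum q (r + 1) * qNum q ((f 0 : ℝ) - f 1 - k + l - r) * ih

theorem norm_sq_spin_k (hk : (k : ℤ) + 1 ≤ f 0 - f 1) :
    qNum q ((f 0 : ℝ) - f 1 - k + l) * ‖spinVec q f A L (k + 1) l r‖ ^ 2 =
      qNum q ((f 0 : ℝ) - f 1 - k + l - r) *
        (qNum q (k + 1) * qNum q ((f 1 : ℝ) - f 2 + k - 1) * qNum q ((f 0 : ℝ) - f 1 - k) /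
        qNum q ((f 0 : ℝ) - f 1 - k + l + 1)) * ‖spinVec q f A L k l r‖ ^ 2 := by
  induction r with
  | zero =>
    have h := hA.norm_sq_highest_k hq (k := k) (l := l) (by linarith)
    simp only [spinVec, pow_zero, Module.End.one_apply, Nat.cast_zero, sub_zero]
    rw [h]
    ring
  | succ r ih =>
    have e : (f 0 : ℝ) - f 1 - ((k + 1 : ℕ) : ℝ) + l - r = (f 0 : ℝ) - f 1 - k + l - (r + 1) := by
      push_cast; ring
    rw [hA.norm_sq_spin_r hq (k := k + 1) (by push_cast; linarith),
      hA.norm_sq_spin_r hq (k := k) (by linarith), e]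
    push_cast
    linear_combination qNum q (r + 1) * qNum q ((f 0 : ℝ) - f 1 - k + l - (r + 1)) * ih

omit hA hq in
theorem F_spin (k l r : ℕ) : A 1 0 (spinVec q f A L k l r) = spinVec q f A L k l (r + 1) :=
  (Module.End.pow_succ_apply _ _ _).symm

theorem E_spin (hk : (k : ℤ) ≤ f 0 - f 1) (l r : ℕ) : A 0 1 (spinVec q f A L k l r) =
    (qNum q r * qNum q ((f 0 : ℝ) - f 1 - k + l - r + 1)) • spinVec q f A L k l (r - 1) := by
  cases r with
  | zero => simp [spinVec, hA.E_highest hq (k := k) (l := l) (by linarith), qNum_zero]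
  | succ r =>
    have e : (f 0 : ℝ) - f 1 - k + l - ((r + 1 : ℕ) : ℝ) + 1 = (f 0 : ℝ) - f 1 - k + l - r := by
      push_cast; ring
    rw [Nat.add_sub_cancel, e, spinVec, hA.rep.E_F_pow hq
      (hA.rep.weight_highestVec hA.weight' _ k l) (hA.E_highest hq (by linarith))
      (show (f 0 : ℝ) - f 1 - k + l = _ by ring)]
    push_cast
    rfl

/-- Out-of-range vectors on the right are zero by `spin_eq_zero`, so no boundary cases are needed
here. In the formulas for C, D and G below, truncated indices come with a vanishing q-number. -/
theorem B_spin (hk : (k : ℤ) ≤ f 0 - f 1) (l r : ℕ) : A 1 2 (spinVec q f A L k l r) =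
    spinVec q f A L (k + 1) l r + (qNum q ((f 0 : ℝ) - f 1 + l + 2) /
      (qNum q ((f 0 : ℝ) - f 1 - k + l + 1) * qNum q ((f 0 : ℝ) - f 1 - k + l + 2))) •
        spinVec q f A L k (l + 1) (r + 1) := by
  rw [spinVec, hA.rep.B_F_pow_highest _ ((f 0 : ℝ) - f 1 - k + l), hA.D_highest hq (by linarith),
    LinearMap.map_smul_of_tower, smul_smul, spinVec, highestVec, spinVec]
  congr 2
  ring

theorem D_spin (hk : (k : ℤ) ≤ f 0 - f 1) (l r : ℕ) : A 0 2 (spinVec q f A L k l r) =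
    (q ^ (-r : ℝ) * (qNum q ((f 0 : ℝ) - f 1 - k + l + 1 - r) * qNum q ((f 0 : ℝ) - f 1 + l + 2) /
      (qNum q ((f 0 : ℝ) - f 1 - k + l + 1) * qNum q ((f 0 : ℝ) - f 1 - k + l + 2)))) •
        spinVec q f A L k (l + 1) r +
      (-q ^ ((f 0 : ℝ) - f 1 - k + l - r + 1) * qNum q r) •
        spinVec q f A L (k + 1) l (r - 1) := by
  have hk' : (k : ℝ) ≤ (f 0 : ℝ) - f 1 := by exact_mod_cast hk
  have hl0 : (0 : ℝ) ≤ l := l.cast_nonneg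
  rw [spinVec, hA.rep.D_F_pow_highest hq (hA.rep.weight_highestVec hA.weight' _ k l)
    (show (f 0 : ℝ) - f 1 - k + l = _ by ring) (by linarith), hA.D_highest hq (by linarith),
    LinearMap.map_smul_of_tower, smul_smul, spinVec, spinVec, highestVec, sub_eq_add_neg,
    ← neg_smul]
  congr 2 <;> ring

theorem C_spin (h0 : f 1 ≤ f 0) (hk : (k : ℤ) ≤ f 0 - f 1) (l r : ℕ) :
    A 2 1 (spinVec q f A L k l r) =
    (-(qNum q r * qNum q l * qNum q ((f 0 : ℝ) - f 2 + l - 1))) •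
        spinVec q f A L k (l - 1) (r - 1) +
      (-(qNum q ((f 0 : ℝ) - f 1 - k + l - r + 1) * (qNum q k * qNum q ((f 1 : ℝ) - f 2 + k - 2) *
        qNum q ((f 0 : ℝ) - f 1 - k + 1)) / (qNum q ((f 0 : ℝ) - f 1 - k + l + 1) *
          qNum q ((f 0 : ℝ) - f 1 - k + l + 2)))) • spinVec q f A L (k - 1) l r := by
  have hk' : (k : ℝ) ≤ (f 0 : ℝ) - f 1 := by exact_mod_cast hk
  have hl0 : (0 : ℝ) ≤ l := l.cast_nonneg
  rw [spinVec, hA.rep.C_F_pow_highest hq (n := (f 0 : ℝ) - f 1 - k + l) _ (by linarith),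
    hA.T_highest hq hk, hA.C_highest hq (by linarith) (by linarith), ← neg_smul, ← neg_smul,
    LinearMap.map_smul_of_tower, LinearMap.map_smul_of_tower, smul_smul, smul_smul, spinVec,
    spinVec]
  congr 2 <;> ring

theorem G_spin (h0 : f 1 ≤ f 0) (hk : (k : ℤ) ≤ f 0 - f 1) (l r : ℕ) :
    A 2 0 (spinVec q f A L k l r) =
    (-q ^ (r : ℝ) * (qNum q l * qNum q ((f 0 : ℝ) - f 2 + l - 1))) •
        spinVec q f A L k (l - 1) r +
      (q ^ (-((f 0 : ℝ) - f 1 - k + l - r + 1)) *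
        (qNum q k * qNum q ((f 1 : ℝ) - f 2 + k - 2) *
        qNum q ((f 0 : ℝ) - f 1 - k + 1) / (qNum q ((f 0 : ℝ) - f 1 - k + l + 1) *
          qNum q ((f 0 : ℝ) - f 1 - k + l + 2)))) • spinVec q f A L (k - 1) l (r + 1) := by
  have hk' : (k : ℝ) ≤ (f 0 : ℝ) - f 1 := by exact_mod_cast hk
  have hl0 : (0 : ℝ) ≤ l := l.cast_nonneg
  rw [spinVec, hA.rep.G_F_pow_highest hq (n := (f 0 : ℝ) - f 1 - k + l) _ (by linarith),
    hA.T_highest hq hk, hA.C_highest hq (by linarith) (by linarith), ← neg_smul, ← neg_smul,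
    LinearMap.map_smul_of_tower, LinearMap.map_smul_of_tower, smul_smul, smul_smul, spinVec,
    spinVec, sub_eq_add_neg, ← neg_smul]
  congr 2 <;> ring

/-- The weights determine l - r and k + r. If both agree, the labels can differ only with r ≠ r',
and then moving the larger power of F across as a power of E annihilates the other vector. -/
theorem inner_spin_eq_zero {k' l' r' : ℕ} (hk : (k : ℤ) ≤ f 0 - f 1) (hk' : (k' : ℤ) ≤ f 0 - f 1)
    (h : ¬(k = k' ∧ l = l' ∧ r = r')) :
    inner ℂ (spinVec q f A L k l r) (spinVec q f A L k' l' r') = 0 := by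
  have hw := hA.weight_spinVec k l r
  have hw' := hA.weight_spinVec k' l' r'
  by_cases h1 : (l : ℤ) - r = l' - r'
  · by_cases h2 : (k : ℤ) + r = k' + r'
    · have hne : r ≠ r' := by omega
      rcases lt_or_gt_of_ne hne with hlt | hlt
      · rw [← inner_conj_symm, spinVec, spinVec, hA.unitary.adj_21_pow, hA.rep.E_pow_F_pow hq
          (hA.rep.weight_highestVec hA.weight' _ k l) (hA.E_highest hq (by linarith)) hlt,
          inner_zero_right, map_zero]
      · rw [spinVec, spinVec, hA.unitary.adj_21_pow, hA.rep.E_pow_F_pow hq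
          (hA.rep.weight_highestVec hA.weight' _ k' l') (hA.E_highest hq (by linarith)) hlt,
          inner_zero_right]
    · refine hA.unitary.inner_eq_zero_of_weight_ne hw hw' (i := 1) fun h3 => h2 ?_
      have h3' : (f 1 : ℝ) + k + r = f 1 + k' + r' := h3
      have : f 1 + (k : ℤ) + r = f 1 + k' + r' := by exact_mod_cast h3'
      omega
  · refine hA.unitary.inner_eq_zero_of_weight_ne hw hw' (i := 0) fun h3 => h1 ?_
    have h3' : (f 0 : ℝ) + l - r = f 0 + l' - r' := h3
    have : f 0 + (l : ℤ) - r = f 0 + l' - r' := by exact_mod_cast h3'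
    omega

end IsLowestWeightUIR

end SpinVectors

/-! ### Recovering the labels k, l, r from m₃, U, M. -/

namespace ULabel

variable {f : Fin 3 → ℤ}

theorem ext' {x y : ULabel f} (h : x.k = y.k ∧ x.l = y.l ∧ x.r = y.r) : x = y := by
  obtain ⟨h1, h2, h3⟩ := h
  cases x; cases y; subst h1 h2 h3; rfl

theorem k_le (x : ULabel f) : (x.k : ℝ) ≤ (f 0 : ℝ) - f 1 := by exact_mod_cast x.hk

theorem r_le (x : ULabel f) : (x.r : ℝ) ≤ (f 0 : ℝ) - f 1 - x.k + x.l := by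
  exact_mod_cast x.hr

/-- m₃ fixes k + l, U fixes l - k, and U - M = r. Everything is doubled so that half-integral shifts
become integer equations. -/
theorem shift_eq {x y : ULabel f} {d e g : ℤ} (h1 : y.m3 = x.m3 + d) (h2 : y.U = x.U + e / 2)
    (h3 : y.M = x.M + g / 2) : 2 * (y.k : ℤ) = 2 * x.k - d - e ∧ 2 * (y.l : ℤ) = 2 * x.l - d + e ∧
      2 * (y.r : ℤ) = 2 * x.r + e - g := by
  rw [M, M, h2] at h3
  rw [U, U] at h2
  rw [m3, m3] at h1
  have h2' : (f 0 : ℝ) - f 1 - y.k + y.l = f 0 - f 1 - x.k + x.l + e := by linarith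
  have h3' : 2 * (y.r : ℝ) = 2 * x.r + e - g := by linarith
  have h2'' : f 0 - f 1 - (y.k : ℤ) + y.l = f 0 - f 1 - x.k + x.l + e := by exact_mod_cast h2'
  exact ⟨by linarith, by linarith, by exact_mod_cast h3'⟩

end ULabel

/-- An algebraic span suffices: v is a finite combination, its coefficients are the inner products,
and so the `finsum` has finite support. -/
theorem Orthonormal.eq_finsum_mem_inner {ι V : Type*} [NormedAddCommGroup V]
    [InnerProductSpace ℂ V] {e : ι → V} (he : Orthonormal ℂ e) {S : Set ι} {v : V}
    (hv : v ∈ Submodule.span ℂ (e '' S)) : v = ∑ᶠ y ∈ S, inner ℂ (e y) v • e y := by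
  obtain ⟨c, hc, rfl⟩ := (Finsupp.mem_span_image_iff_linearCombination ℂ).1 hv
  simp only [he.inner_right_finsupp]
  rw [Finsupp.mem_supported] at hc
  rw [finsum_mem_eq_sum_of_inter_support_eq (t := c.support)]
  · rfl
  · ext y
    simp only [Set.mem_inter_iff, Function.mem_support, Finset.mem_coe, Finsupp.mem_support_iff]
    constructor
    · rintro ⟨_, h2⟩
      exact ⟨fun h => h2 (by rw [h, zero_smul]), h2⟩
    · rintro ⟨h1, h2⟩
      exact ⟨hc (Finsupp.mem_support_iff.2 h1), h2⟩

/-! ### The kets as normalized spin vectors, and their inner products. -/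

section Kets

variable {V : Type*} [NormedAddCommGroup V] [InnerProductSpace ℂ V] {q : ℝ}
  {A : Fin 3 → Fin 3 → Module.End ℂ V} {f : Fin 3 → ℤ} {L : V}

namespace IsLowestWeightUIR

variable (hA : IsLowestWeightUIR q f A L) (hq : 0 < q)
include hA hq

/-- Multiplying the ratios [r+1][2U-r] of successive squared norms along the F-string gives
[2U]![r]!/[2U-r]!, the square of `uNormFactor`. -/
theorem norm_spin_eq (x : ULabel f) : ‖spinVec q f A L x.k x.l x.r‖ =
    ‖highestVec q A ((f 0 : ℝ) - f 1) L x.k x.l‖ * uNormFactor q x := by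
  have h : ∀ r : ℕ, r ≤ x.twoU → qFactorial q (x.twoU - r) * ‖spinVec q f A L x.k x.l r‖ ^ 2 =
      qFactorial q x.twoU * qFactorial q r *
        ‖highestVec q A ((f 0 : ℝ) - f 1) L x.k x.l‖ ^ 2 := by
    intro r hr
    induction r with
    | zero => simp [qFactorial_zero, spinVec]
    | succ r ih =>
      have e : x.twoU - r = x.twoU - (r + 1) + 1 := by omega
      have ih := ih (by omega)
      have e' : ((x.twoU - (r + 1) : ℕ) : ℝ) + 1 = (f 0 : ℝ) - f 1 - x.k + x.l - r := by
        rw [Nat.cast_sub hr, x.twoU_cast]; push_cast; ring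
      rw [e, qFactorial_succ, e'] at ih
      rw [hA.norm_sq_spin_r hq x.hk, qFactorial_succ]
      linear_combination qNum q (r + 1) * ih
  have hr : x.r ≤ x.twoU := by
    have h1 := x.r_le
    rw [← x.twoU_cast] at h1
    exact_mod_cast h1
  have h0 := (qFactorial_pos hq (x.twoU - x.r)).ne'
  have hnn : 0 ≤ qFactorial q x.twoU * qFactorial q x.r / qFactorial q (x.twoU - x.r) :=
    div_nonneg (mul_nonneg (qFactorial_pos hq _).le (qFactorial_pos hq _).le)
      (qFactorial_pos hq _).le
  rw [uNormFactor,
    ← sq_eq_sq₀ (norm_nonneg _) (mul_nonneg (norm_nonneg _) (Real.sqrt_nonneg _)), mul_pow, Real.sq_sqrt hnn, mul_div_assoc', eq_div_iff h0]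
  linear_combination h x.r hr

theorem ket_eq (x : ULabel f) : uKet q A L x =
    (‖spinVec q f A L x.k x.l x.r‖⁻¹ : ℝ) • spinVec q f A L x.k x.l x.r := by
  have h := hA.rep.uHighest_eq hq hA.weight' hA.raise_12 x
  rw [uKet, h, ← hA.norm_spin_eq hq, Complex.coe_smul, spinVec]

variable (hf : IsPositiveSignature f)
include hf

theorem norm_spin_pos (x : ULabel f) : 0 < ‖spinVec q f A L x.k x.l x.r‖ := by
  have h := hA.norm_sq_spin_pos hq hf x.hk x.hr
  exact (norm_nonneg _).lt_of_ne' fun h0 => by simp [h0] at h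

theorem spin_eq_smul_ket (x : ULabel f) : spinVec q f A L x.k x.l x.r =
    ‖spinVec q f A L x.k x.l x.r‖ • uKet q A L x := by
  rw [hA.ket_eq hq, smul_smul, mul_inv_cancel₀ (hA.norm_spin_pos hq hf x).ne', one_smul]

theorem spin_mem_span {S : Set (ULabel f)} {k l r : ℕ}
    (h : ∀ y : ULabel f, y.k = k → y.l = l → y.r = r → y ∈ S) :
    spinVec q f A L k l r ∈ Submodule.span ℂ (uKet q A L '' S) := by
  by_cases hv : (k : ℤ) ≤ f 0 - f 1 ∧ (r : ℤ) ≤ f 0 - f 1 - k + l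
  · have := hA.spin_eq_smul_ket hq hf ⟨k, l, r, hv.1, hv.2⟩
    simp only at this
    rw [this, ← Complex.coe_smul]
    exact Submodule.smul_mem _ _ (Submodule.subset_span ⟨_, h _ rfl rfl rfl, rfl⟩)
  · rw [hA.spin_eq_zero hq hf.1 hv]
    exact Submodule.zero_mem _

theorem inner_ket_spin_self (y : ULabel f) :
    inner ℂ (uKet q A L y) (spinVec q f A L y.k y.l y.r) =
      (‖spinVec q f A L y.k y.l y.r‖ : ℂ) := by
  have h := (hA.norm_spin_pos hq hf y).ne'
  rw [hA.ket_eq hq, ← Complex.coe_smul, inner_smul_left, Complex.conj_ofReal,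
    inner_self_eq_norm_sq_to_K]
  change ((‖spinVec q f A L y.k y.l y.r‖⁻¹ : ℝ) : ℂ) *
    ((‖spinVec q f A L y.k y.l y.r‖ : ℝ) : ℂ) ^ 2 = _
  rw [← Complex.ofReal_pow, ← Complex.ofReal_mul, sq, inv_mul_cancel_left₀ h]

theorem inner_ket_spin_of_ne (y : ULabel f) {k l r : ℕ} (h : ¬(y.k = k ∧ y.l = l ∧ y.r = r)) :
    inner ℂ (uKet q A L y) (spinVec q f A L k l r) = 0 := by
  by_cases hv : (k : ℤ) ≤ f 0 - f 1 ∧ (r : ℤ) ≤ f 0 - f 1 - k + l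
  · rw [hA.ket_eq hq, ← Complex.coe_smul, inner_smul_left,
      hA.inner_spin_eq_zero hq y.hk hv.1 h, mul_zero]
  · rw [hA.spin_eq_zero hq hf.1 hv, inner_zero_right]

theorem orthonormal_ket : Orthonormal ℂ (uKet q A L : ULabel f → V) := by
  refine ⟨fun x => ?_, fun x y hxy => ?_⟩
  · have h := hA.norm_spin_pos hq hf x
    rw [hA.ket_eq hq, norm_smul, norm_inv, norm_norm, inv_mul_cancel₀ h.ne']
  · simp only
    rw [hA.ket_eq hq y, ← Complex.coe_smul, inner_smul_right,
      hA.inner_ket_spin_of_ne hq hf x fun h => hxy (ULabel.ext' h), mul_zero]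

omit hf in
theorem mem_span_of_spin {S : Set (ULabel f)} (T : Module.End ℂ V) (x : ULabel f)
    (h : T (spinVec q f A L x.k x.l x.r) ∈ Submodule.span ℂ (uKet q A L '' S)) :
    T (uKet q A L x) ∈ Submodule.span ℂ (uKet q A L '' S) := by
  rw [hA.ket_eq hq, ← Complex.coe_smul, map_smul]
  exact Submodule.smul_mem _ _ h

/-- The matrix element is s t ‖y‖/‖x‖ for the corresponding spin vectors. Here s holds the sign and
power of q, t ≥ 0 the rest, and Y is the square of t ‖y‖/‖x‖; the second term of T drops out by
orthogonality. -/
theorem inner_ket_apply (x y : ULabel f) (T : Module.End ℂ V) {s t u Y : ℝ} {k l r : ℕ}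
    (hT : T (spinVec q f A L x.k x.l x.r) =
      (s * t) • spinVec q f A L y.k y.l y.r + u • spinVec q f A L k l r)
    (hne : ¬(y.k = k ∧ y.l = l ∧ y.r = r)) (ht : 0 ≤ t)
    (hY : t ^ 2 * ‖spinVec q f A L y.k y.l y.r‖ ^ 2 =
      Y * ‖spinVec q f A L x.k x.l x.r‖ ^ 2) :
    inner ℂ (uKet q A L y) (T (uKet q A L x)) = ((s * √Y : ℝ) : ℂ) := by
  have hx := hA.norm_spin_pos hq hf x
  have key : t * ‖spinVec q f A L y.k y.l y.r‖ = √Y * ‖spinVec q f A L x.k x.l x.r‖ := by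
    have hY' : Y = (t * ‖spinVec q f A L y.k y.l y.r‖ / ‖spinVec q f A L x.k x.l x.r‖) ^ 2 := by
      field_simp
      linear_combination -hY
    rw [hY', Real.sqrt_sq (by positivity), div_mul_cancel₀ _ hx.ne']
  rw [hA.ket_eq hq x, LinearMap.map_smul_of_tower, hT, ← Complex.coe_smul, inner_smul_right,
    inner_add_right, ← Complex.coe_smul, ← Complex.coe_smul, inner_smul_right, inner_smul_right,
    hA.inner_ket_spin_of_ne hq hf y hne, hA.inner_ket_spin_self hq hf, mul_zero, add_zero,
    ← Complex.ofReal_mul, ← Complex.ofReal_mul, mul_assoc s, key]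
  congr 1
  field_simp

theorem apply_ket (x y : ULabel f) (T : Module.End ℂ V) {t Y : ℝ}
    (hT : T (spinVec q f A L x.k x.l x.r) = t • spinVec q f A L y.k y.l y.r) (ht : 0 ≤ t)
    (hY : t ^ 2 * ‖spinVec q f A L y.k y.l y.r‖ ^ 2 =
      Y * ‖spinVec q f A L x.k x.l x.r‖ ^ 2) :
    T (uKet q A L x) = ((√Y : ℝ) : ℂ) • uKet q A L y := by
  have hx := hA.norm_spin_pos hq hf x
  have key : t * ‖spinVec q f A L y.k y.l y.r‖ = √Y * ‖spinVec q f A L x.k x.l x.r‖ := by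
    have hY' : Y = (t * ‖spinVec q f A L y.k y.l y.r‖ / ‖spinVec q f A L x.k x.l x.r‖) ^ 2 := by
      field_simp
      linear_combination -hY
    rw [hY', Real.sqrt_sq (by positivity), div_mul_cancel₀ _ hx.ne']
  rw [hA.ket_eq hq x, LinearMap.map_smul_of_tower, hT, hA.spin_eq_smul_ket hq hf y, smul_smul,
    smul_smul, mul_assoc, key, Complex.coe_smul]
  congr 1
  field_simp

end IsLowestWeightUIR

end Kets

/-! ### The eight matrix elements: coefficients from the spin-vector formulas, norm ratios from
`norm_sq_spin_l`, `norm_sq_spin_k` and `norm_sq_spin_r`. -/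

section MatrixElements

variable {V : Type*} [NormedAddCommGroup V] [InnerProductSpace ℂ V] {q : ℝ}
  {A : Fin 3 → Fin 3 → Module.End ℂ V} {f : Fin 3 → ℤ} {L : V}

theorem IsPositiveSignature.two_le (hf : IsPositiveSignature f) {k : ℕ} (hk : k ≠ 0)
    (h : (k : ℤ) ≤ f 0 - f 1) : (2 : ℝ) ≤ (f 1 : ℝ) - f 2 := by
  rcases hf.2.2 with h3 | h3
  · exact_mod_cast h3
  · omega

theorem IsPositiveSignature.one_le (hf : IsPositiveSignature f) : (1 : ℝ) ≤ (f 0 : ℝ) - f 2 := by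
  exact_mod_cast hf.2.1

namespace IsLowestWeightUIR

variable (hA : IsLowestWeightUIR q f A L) (hq : 0 < q) (hf : IsPositiveSignature f)
  (x y : ULabel f)
include hA hq hf

theorem inner_13_l (hk : y.k = x.k) (hl : y.l = x.l + 1) (hr : y.r = x.r) :
    inner ℂ (uKet q A L y) (A 0 2 (uKet q A L x)) =
      ((q ^ (-x.U + x.M) * √((qNum q (x.l + 1) * qNum q (f 0 - f 2 + x.l) *
          qNum q (2 * x.U + x.k + 2) * qNum q (x.U + x.M + 1)) /
        (qNum q (2 * x.U + 1) * qNum q (2 * x.U + 2))) : ℝ) : ℂ) := by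
  have hx := x.k_le
  have hxr := x.r_le
  have h0 := hf.one_le
  have k0 : (0 : ℝ) ≤ x.k := x.k.cast_nonneg
  have l0 : (0 : ℝ) ≤ x.l := x.l.cast_nonneg
  have r0 : (0 : ℝ) ≤ x.r := x.r.cast_nonneg
  have n1 := qNum_pos hq (show 0 < (f 0 : ℝ) - f 1 - x.k + x.l + 1 by linarith)
  have n2 := qNum_pos hq (show 0 < (f 0 : ℝ) - f 1 - x.k + x.l + 2 by linarith)
  have e1 : -x.U + x.M = -(x.r : ℝ) := by
    simp only [ULabel.M, ULabel.U]; ring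
  have e2 : 2 * x.U + x.k + 2 = (f 0 : ℝ) - f 1 + x.l + 2 := by
    simp only [ULabel.U]; ring
  have e3 : x.U + x.M + 1 = (f 0 : ℝ) - f 1 - x.k + x.l + 1 - x.r := by
    simp only [ULabel.M, ULabel.U]; ring
  have e4 : 2 * x.U = (f 0 : ℝ) - f 1 - x.k + x.l := by rw [ULabel.U]; ring
  have hN := hA.norm_sq_spin_l hq (l := x.l) (r := x.r) x.hk
  rw [e1, e2, e3, e4]
  refine hA.inner_ket_apply hq hf x y _ (by rw [hk, hl, hr]; exact hA.D_spin hq x.hk x.l x.r)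
    (by omega) (div_nonneg (mul_nonneg (qNum_nonneg hq (by linarith))
      (qNum_nonneg hq (by linarith))) (mul_nonneg n1.le n2.le)) ?_
  rw [hk, hl, hr]
  field_simp at hN ⊢
  linear_combination qNum q ((f 0 : ℝ) - f 1 - x.k + x.l + 1 - x.r) *
    qNum q ((f 0 : ℝ) - f 1 + x.l + 2) * hN

theorem inner_23_l (hk : y.k = x.k) (hl : y.l = x.l + 1) (hr : y.r = x.r + 1) :
    inner ℂ (uKet q A L y) (A 1 2 (uKet q A L x)) =
      ((√((qNum q (x.l + 1) * qNum q (f 0 - f 2 + x.l) *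
          qNum q (2 * x.U + x.k + 2) * qNum q (x.U - x.M + 1)) /
        (qNum q (2 * x.U + 1) * qNum q (2 * x.U + 2))) : ℝ) : ℂ) := by
  have hx := x.k_le
  have hxr := x.r_le
  have h0 := hf.one_le
  have k0 : (0 : ℝ) ≤ x.k := x.k.cast_nonneg
  have l0 : (0 : ℝ) ≤ x.l := x.l.cast_nonneg
  have r0 : (0 : ℝ) ≤ x.r := x.r.cast_nonneg
  have n1 := qNum_pos hq (show 0 < (f 0 : ℝ) - f 1 - x.k + x.l + 1 by linarith)
  have n2 := qNum_pos hq (show 0 < (f 0 : ℝ) - f 1 - x.k + x.l + 2 by linarith)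
  have e2 : 2 * x.U + x.k + 2 = (f 0 : ℝ) - f 1 + x.l + 2 := by
    simp only [ULabel.U]; ring
  have e3 : x.U - x.M + 1 = (x.r : ℝ) + 1 := by
    simp only [ULabel.M, ULabel.U]; ring
  have e4 : 2 * x.U = (f 0 : ℝ) - f 1 - x.k + x.l := by rw [ULabel.U]; ring
  have hN := hA.norm_sq_spin_l hq (l := x.l) (r := x.r) x.hk
  have hR := hA.norm_sq_spin_r hq (l := x.l + 1) (r := x.r) x.hk
  have e5 : (f 0 : ℝ) - f 1 - x.k + ((x.l + 1 : ℕ) : ℝ) - x.r =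
      (f 0 : ℝ) - f 1 - x.k + x.l + 1 - x.r := by push_cast; ring
  rw [e5] at hR
  have hT := hA.B_spin hq x.hk x.l x.r
  rw [← one_smul ℝ (spinVec q f A L (x.k + 1) x.l x.r), add_comm, ← one_mul (_ / _ : ℝ)] at hT
  rw [e2, e3, e4, ← one_mul (√_)]
  refine hA.inner_ket_apply hq hf x y _ (by rw [hk, hl, hr]; exact hT)
    (by omega) (div_nonneg (qNum_nonneg hq (by linarith)) (mul_nonneg n1.le n2.le)) ?_
  rw [hk, hl, hr, hR]
  field_simp at hN ⊢
  linear_combination qNum q (x.r + 1) * qNum q ((f 0 : ℝ) - f 1 + x.l + 2) * hN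

theorem inner_13_k (hk : y.k = x.k + 1) (hl : y.l = x.l) (hr : y.r + 1 = x.r) :
    inner ℂ (uKet q A L y) (A 0 2 (uKet q A L x)) =
      ((-q ^ (x.U + x.M + 1) * √((qNum q (x.k + 1) * qNum q (f 1 - f 2 + x.k - 1) *
          qNum q (2 * x.U - x.l) * qNum q (x.U - x.M)) /
        (qNum q (2 * x.U) * qNum q (2 * x.U + 1))) : ℝ) : ℂ) := by
  have hx := x.k_le
  have hxr := x.r_le
  have h0 := hf.one_le
  have k0 : (0 : ℝ) ≤ x.k := x.k.cast_nonneg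
  have l0 : (0 : ℝ) ≤ x.l := x.l.cast_nonneg
  have r0 : (0 : ℝ) ≤ x.r := x.r.cast_nonneg
  have hy := y.hk
  have hk' : (x.k : ℝ) + 1 ≤ (f 0 : ℝ) - f 1 := by
    have := y.k_le; rw [hk] at this; push_cast at this; exact this
  -- Existence of the target forces k + 1 ≤ f₁ - f₂, so 2U > 0 and the denominator [2U] is nonzero.
  have n0 := qNum_pos hq (show 0 < (f 0 : ℝ) - f 1 - x.k + x.l by linarith)
  have n1 := qNum_pos hq (show 0 < (f 0 : ℝ) - f 1 - x.k + x.l + 1 by linarith)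
  have e1 : x.U + x.M + 1 = (f 0 : ℝ) - f 1 - x.k + x.l - x.r + 1 := by
    simp only [ULabel.M, ULabel.U]; ring
  have e2 : 2 * x.U - x.l = (f 0 : ℝ) - f 1 - x.k := by
    simp only [ULabel.U]; ring
  have e3 : x.U - x.M = (x.r : ℝ) := by
    simp only [ULabel.M, ULabel.U]; ring
  have e4 : 2 * x.U = (f 0 : ℝ) - f 1 - x.k + x.l := by rw [ULabel.U]; ring
  have hN := hA.norm_sq_spin_k hq (k := x.k) (l := x.l) (r := y.r) (by rw [hk] at hy; exact hy)
  have hR := hA.norm_sq_spin_r hq (l := x.l) (r := y.r) x.hk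
  have hr' : (y.r : ℝ) + 1 = x.r := by exact_mod_cast hr
  rw [hr, hr'] at hR
  rw [e1, e2, e3, e4]
  refine hA.inner_ket_apply hq hf x y _
    (by rw [hk, hl, show y.r = x.r - 1 by omega, add_comm]; exact hA.D_spin hq x.hk x.l x.r)
    (by omega) (qNum_nonneg hq r0) ?_
  rw [hk, hl, hR]
  field_simp at hN ⊢
  linear_combination qNum q x.r ^ 2 * hN

theorem inner_23_k (hk : y.k = x.k + 1) (hl : y.l = x.l) (hr : y.r = x.r) :
    inner ℂ (uKet q A L y) (A 1 2 (uKet q A L x)) =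
      ((√((qNum q (x.k + 1) * qNum q (f 1 - f 2 + x.k - 1) *
          qNum q (2 * x.U - x.l) * qNum q (x.U + x.M)) /
        (qNum q (2 * x.U) * qNum q (2 * x.U + 1))) : ℝ) : ℂ) := by
  have hx := x.k_le
  have hxr := x.r_le
  have h0 := hf.one_le
  have k0 : (0 : ℝ) ≤ x.k := x.k.cast_nonneg
  have l0 : (0 : ℝ) ≤ x.l := x.l.cast_nonneg
  have r0 : (0 : ℝ) ≤ x.r := x.r.cast_nonneg
  have hy := y.hk
  have hk' : (x.k : ℝ) + 1 ≤ (f 0 : ℝ) - f 1 := by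
    have := y.k_le; rw [hk] at this; push_cast at this; exact this
  have n0 := qNum_pos hq (show 0 < (f 0 : ℝ) - f 1 - x.k + x.l by linarith)
  have n1 := qNum_pos hq (show 0 < (f 0 : ℝ) - f 1 - x.k + x.l + 1 by linarith)
  have e2 : 2 * x.U - x.l = (f 0 : ℝ) - f 1 - x.k := by
    simp only [ULabel.U]; ring
  have e3 : x.U + x.M = (f 0 : ℝ) - f 1 - x.k + x.l - x.r := by
    simp only [ULabel.M, ULabel.U]; ring
  have e4 : 2 * x.U = (f 0 : ℝ) - f 1 - x.k + x.l := by rw [ULabel.U]; ring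
  have hN := hA.norm_sq_spin_k hq (k := x.k) (l := x.l) (r := x.r) (by rw [hk] at hy; exact hy)
  have hT := hA.B_spin hq x.hk x.l x.r
  rw [← one_smul ℝ (spinVec q f A L (x.k + 1) x.l x.r), ← one_mul (1 : ℝ)] at hT
  rw [e2, e3, e4, ← one_mul (√_)]
  refine hA.inner_ket_apply hq hf x y _ (by rw [hk, hl, hr]; exact hT)
    (by omega) zero_le_one ?_
  rw [hk, hl, hr]
  field_simp at hN ⊢
  linear_combination hN

theorem inner_31_l (hk : y.k = x.k) (hl : y.l + 1 = x.l) (hr : y.r = x.r) :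
    inner ℂ (uKet q A L y) (A 2 0 (uKet q A L x)) =
      ((-q ^ (x.U - x.M) * √((qNum q x.l * qNum q (f 0 - f 2 + x.l - 1) *
          qNum q (2 * x.U + x.k + 1) * qNum q (x.U + x.M)) /
        (qNum q (2 * x.U) * qNum q (2 * x.U + 1))) : ℝ) : ℂ) := by
  have hx := x.k_le
  have hxr := x.r_le
  have h0 := hf.one_le
  have k0 : (0 : ℝ) ≤ x.k := x.k.cast_nonneg
  have l0 : (0 : ℝ) ≤ x.l := x.l.cast_nonneg
  have r0 : (0 : ℝ) ≤ x.r := x.r.cast_nonneg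
  have hl' : (y.l : ℝ) + 1 = x.l := by exact_mod_cast hl
  have l0' : (0 : ℝ) ≤ y.l := y.l.cast_nonneg
  -- Here 2U > 0 because the existence of the target forces l ≥ 1.
  have n0 := qNum_pos hq (show 0 < (f 0 : ℝ) - f 1 - x.k + x.l by linarith)
  have n1 := qNum_pos hq (show 0 < (f 0 : ℝ) - f 1 - x.k + x.l + 1 by linarith)
  have e1 : x.U - x.M = (x.r : ℝ) := by
    simp only [ULabel.M, ULabel.U]; ring
  have e2 : 2 * x.U + x.k + 1 = (f 0 : ℝ) - f 1 + x.l + 1 := by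
    simp only [ULabel.U]; ring
  have e3 : x.U + x.M = (f 0 : ℝ) - f 1 - x.k + x.l - x.r := by
    simp only [ULabel.M, ULabel.U]; ring
  have e4 : 2 * x.U = (f 0 : ℝ) - f 1 - x.k + x.l := by rw [ULabel.U]; ring
  have hN := hA.norm_sq_spin_l hq (l := y.l) (r := x.r) x.hk
  have e5 : (f 0 : ℝ) - f 1 - x.k + y.l + 1 = (f 0 : ℝ) - f 1 - x.k + x.l := by
    rw [← hl']; ring
  have e6 : (f 0 : ℝ) - f 1 - x.k + y.l + 2 = (f 0 : ℝ) - f 1 - x.k + x.l + 1 := by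
    rw [← hl']; ring
  have e7 : (f 0 : ℝ) - f 1 + y.l + 2 = (f 0 : ℝ) - f 1 + x.l + 1 := by
    rw [← hl']; ring
  have e8 : (f 0 : ℝ) - f 2 + y.l = (f 0 : ℝ) - f 2 + x.l - 1 := by
    rw [← hl']; ring
  rw [hl, e5, e6, e7, e8, hl'] at hN
  rw [e1, e2, e3, e4]
  refine hA.inner_ket_apply hq hf x y _
    (by rw [hk, show y.l = x.l - 1 by omega, hr]; exact hA.G_spin hq hf.1 x.hk x.l x.r)
    (by omega) (mul_nonneg (qNum_nonneg hq l0) (qNum_nonneg hq (by linarith))) ?_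
  rw [hk, hr]
  field_simp at hN ⊢
  linear_combination -(qNum q x.l * qNum q ((f 0 : ℝ) - f 2 + x.l - 1)) * hN

theorem inner_32_l (hk : y.k = x.k) (hl : y.l + 1 = x.l) (hr : y.r + 1 = x.r) :
    inner ℂ (uKet q A L y) (A 2 1 (uKet q A L x)) =
      ((-√((qNum q x.l * qNum q (f 0 - f 2 + x.l - 1) *
          qNum q (2 * x.U + x.k + 1) * qNum q (x.U - x.M)) /
        (qNum q (2 * x.U) * qNum q (2 * x.U + 1))) : ℝ) : ℂ) := by
  have hx := x.k_le
  have hxr := x.r_le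
  have h0 := hf.one_le
  have k0 : (0 : ℝ) ≤ x.k := x.k.cast_nonneg
  have l0 : (0 : ℝ) ≤ x.l := x.l.cast_nonneg
  have r0 : (0 : ℝ) ≤ x.r := x.r.cast_nonneg
  have hl' : (y.l : ℝ) + 1 = x.l := by exact_mod_cast hl
  have l0' : (0 : ℝ) ≤ y.l := y.l.cast_nonneg
  have n0 := qNum_pos hq (show 0 < (f 0 : ℝ) - f 1 - x.k + x.l by linarith)
  have n1 := qNum_pos hq (show 0 < (f 0 : ℝ) - f 1 - x.k + x.l + 1 by linarith)
  have e2 : 2 * x.U + x.k + 1 = (f 0 : ℝ) - f 1 + x.l + 1 := by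
    simp only [ULabel.U]; ring
  have e3 : x.U - x.M = (x.r : ℝ) := by
    simp only [ULabel.M, ULabel.U]; ring
  have e4 : 2 * x.U = (f 0 : ℝ) - f 1 - x.k + x.l := by rw [ULabel.U]; ring
  have hN := hA.norm_sq_spin_l hq (l := y.l) (r := y.r) x.hk
  have e5 : (f 0 : ℝ) - f 1 - x.k + y.l + 1 = (f 0 : ℝ) - f 1 - x.k + x.l := by
    rw [← hl']; ring
  have e6 : (f 0 : ℝ) - f 1 - x.k + y.l + 2 = (f 0 : ℝ) - f 1 - x.k + x.l + 1 := by
    rw [← hl']; ring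
  have e7 : (f 0 : ℝ) - f 1 + y.l + 2 = (f 0 : ℝ) - f 1 + x.l + 1 := by
    rw [← hl']; ring
  have e8 : (f 0 : ℝ) - f 2 + y.l = (f 0 : ℝ) - f 2 + x.l - 1 := by
    rw [← hl']; ring
  rw [hl, e5, e6, e7, e8, hl'] at hN
  have hR := hA.norm_sq_spin_r hq (l := x.l) (r := y.r) x.hk
  have hr' : (y.r : ℝ) + 1 = x.r := by exact_mod_cast hr
  rw [hr, hr'] at hR
  rw [e2, e3, e4, ← neg_one_mul]
  refine hA.inner_ket_apply hq hf x y _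
    (by rw [hk, show y.l = x.l - 1 by omega, show y.r = x.r - 1 by omega, neg_one_mul]
        exact hA.C_spin hq hf.1 x.hk x.l x.r)
    (by omega) (mul_nonneg (mul_nonneg (qNum_nonneg hq r0) (qNum_nonneg hq l0))
      (qNum_nonneg hq (by linarith))) ?_
  rw [hk, hR]
  field_simp at hN ⊢
  linear_combination -(qNum q x.r ^ 2 * qNum q x.l * qNum q ((f 0 : ℝ) - f 2 + x.l - 1)) * hN

theorem inner_31_k (hk : y.k + 1 = x.k) (hl : y.l = x.l) (hr : y.r = x.r + 1) :
    inner ℂ (uKet q A L y) (A 2 0 (uKet q A L x)) =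
      ((q ^ (-x.U - x.M - 1) * √((qNum q x.k * qNum q (f 1 - f 2 + x.k - 2) *
          qNum q (2 * x.U - x.l + 1) * qNum q (x.U - x.M + 1)) /
        (qNum q (2 * x.U + 1) * qNum q (2 * x.U + 2))) : ℝ) : ℂ) := by
  have hx := x.k_le
  have hxr := x.r_le
  have h0 := hf.one_le
  have k0 : (0 : ℝ) ≤ x.k := x.k.cast_nonneg
  have l0 : (0 : ℝ) ≤ x.l := x.l.cast_nonneg
  have r0 : (0 : ℝ) ≤ x.r := x.r.cast_nonneg
  have hk' : (y.k : ℝ) + 1 = x.k := by exact_mod_cast hk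
  have k0' : (0 : ℝ) ≤ y.k := y.k.cast_nonneg
  -- Since x.k ≥ 1, f₁ = f₂ is impossible; the bound keeps [f₂ - f₃ + k - 2] nonnegative.
  have h2 := hf.two_le (show x.k ≠ 0 by omega) x.hk
  have n1 := qNum_pos hq (show 0 < (f 0 : ℝ) - f 1 - x.k + x.l + 1 by linarith)
  have n2 := qNum_pos hq (show 0 < (f 0 : ℝ) - f 1 - x.k + x.l + 2 by linarith)
  have e1 : -x.U - x.M - 1 = -((f 0 : ℝ) - f 1 - x.k + x.l - x.r + 1) := by
    simp only [ULabel.M, ULabel.U]; ring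
  have e2 : 2 * x.U - x.l + 1 = (f 0 : ℝ) - f 1 - x.k + 1 := by
    simp only [ULabel.U]; ring
  have e3 : x.U - x.M + 1 = (x.r : ℝ) + 1 := by
    simp only [ULabel.M, ULabel.U]; ring
  have e4 : 2 * x.U = (f 0 : ℝ) - f 1 - x.k + x.l := by rw [ULabel.U]; ring
  have hN := hA.norm_sq_spin_k hq (k := y.k) (l := x.l) (r := x.r)
    (by have := x.hk; rw [← hk] at this; exact_mod_cast this)
  have e5 : (f 0 : ℝ) - f 1 - y.k + x.l = (f 0 : ℝ) - f 1 - x.k + x.l + 1 := by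
    rw [← hk']; ring
  have e6 : (f 0 : ℝ) - f 1 - y.k = (f 0 : ℝ) - f 1 - x.k + 1 := by rw [← hk']; ring
  have e7 : (f 1 : ℝ) - f 2 + y.k - 1 = (f 1 : ℝ) - f 2 + x.k - 2 := by rw [← hk']; ring
  have e8 : (f 0 : ℝ) - f 1 - x.k + x.l + 1 - x.r = (f 0 : ℝ) - f 1 - x.k + x.l - x.r + 1 := by
    ring
  rw [e5, e6, e7, hk, hk', add_assoc _ (1 : ℝ) 1, one_add_one_eq_two, e8] at hN
  have hR := hA.norm_sq_spin_r hq (k := y.k) (l := x.l) (r := x.r) y.hk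
  rw [e5, e8] at hR
  rw [e1, e2, e3, e4]
  refine hA.inner_ket_apply hq hf x y _
    (by rw [hl, show y.k = x.k - 1 by omega, hr, add_comm]; exact hA.G_spin hq hf.1 x.hk x.l x.r)
    (by omega) (div_nonneg (mul_nonneg (mul_nonneg (qNum_nonneg hq k0)
      (qNum_nonneg hq (by linarith))) (qNum_nonneg hq (by linarith)))
      (mul_nonneg n1.le n2.le)) ?_
  rw [hl, hr, hR]
  field_simp at hN ⊢
  linear_combination -(qNum q (x.r + 1) * qNum q x.k * qNum q ((f 1 : ℝ) - f 2 + x.k - 2) *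
    qNum q ((f 0 : ℝ) - f 1 - x.k + 1)) * hN

theorem inner_32_k (hk : y.k + 1 = x.k) (hl : y.l = x.l) (hr : y.r = x.r) :
    inner ℂ (uKet q A L y) (A 2 1 (uKet q A L x)) =
      ((-√((qNum q x.k * qNum q (f 1 - f 2 + x.k - 2) *
          qNum q (2 * x.U - x.l + 1) * qNum q (x.U + x.M + 1)) /
        (qNum q (2 * x.U + 1) * qNum q (2 * x.U + 2))) : ℝ) : ℂ) := by
  have hx := x.k_le
  have hxr := x.r_le
  have h0 := hf.one_le
  have k0 : (0 : ℝ) ≤ x.k := x.k.cast_nonneg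
  have l0 : (0 : ℝ) ≤ x.l := x.l.cast_nonneg
  have r0 : (0 : ℝ) ≤ x.r := x.r.cast_nonneg
  have hk' : (y.k : ℝ) + 1 = x.k := by exact_mod_cast hk
  have k0' : (0 : ℝ) ≤ y.k := y.k.cast_nonneg
  have h2 := hf.two_le (show x.k ≠ 0 by omega) x.hk
  have n1 := qNum_pos hq (show 0 < (f 0 : ℝ) - f 1 - x.k + x.l + 1 by linarith)
  have n2 := qNum_pos hq (show 0 < (f 0 : ℝ) - f 1 - x.k + x.l + 2 by linarith)
  have e2 : 2 * x.U - x.l + 1 = (f 0 : ℝ) - f 1 - x.k + 1 := by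
    simp only [ULabel.U]; ring
  have e3 : x.U + x.M + 1 = (f 0 : ℝ) - f 1 - x.k + x.l - x.r + 1 := by
    simp only [ULabel.M, ULabel.U]; ring
  have e4 : 2 * x.U = (f 0 : ℝ) - f 1 - x.k + x.l := by rw [ULabel.U]; ring
  have hN := hA.norm_sq_spin_k hq (k := y.k) (l := x.l) (r := x.r)
    (by have := x.hk; rw [← hk] at this; exact_mod_cast this)
  have e5 : (f 0 : ℝ) - f 1 - y.k + x.l = (f 0 : ℝ) - f 1 - x.k + x.l + 1 := by
    rw [← hk']; ring
  have e6 : (f 0 : ℝ) - f 1 - y.k = (f 0 : ℝ) - f 1 - x.k + 1 := by rw [← hk']; ring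
  have e7 : (f 1 : ℝ) - f 2 + y.k - 1 = (f 1 : ℝ) - f 2 + x.k - 2 := by rw [← hk']; ring
  have e8 : (f 0 : ℝ) - f 1 - x.k + x.l + 1 - x.r = (f 0 : ℝ) - f 1 - x.k + x.l - x.r + 1 := by
    ring
  rw [e5, e6, e7, hk, hk', add_assoc _ (1 : ℝ) 1, one_add_one_eq_two, e8] at hN
  have hT := hA.C_spin hq hf.1 x.hk x.l x.r
  rw [add_comm, ← neg_one_mul (_ / _ : ℝ)] at hT
  rw [e2, e3, e4, ← neg_one_mul]
  refine hA.inner_ket_apply hq hf x y _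
    (by rw [hl, show y.k = x.k - 1 by omega, hr]; exact hT)
    (by omega) (div_nonneg (mul_nonneg (qNum_nonneg hq (by linarith)) (mul_nonneg (mul_nonneg
      (qNum_nonneg hq k0) (qNum_nonneg hq (by linarith))) (qNum_nonneg hq (by linarith))))
      (mul_nonneg n1.le n2.le)) ?_
  rw [hl, hr]
  field_simp at hN ⊢
  linear_combination -(qNum q ((f 0 : ℝ) - f 1 - x.k + x.l - x.r + 1) * qNum q x.k *
    qNum q ((f 1 : ℝ) - f 2 + x.k - 2) * qNum q ((f 0 : ℝ) - f 1 - x.k + 1)) * hN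

end IsLowestWeightUIR

end MatrixElements

/-! ### Expansion of the noncompact generators on kets, weights, and completeness. -/

section Action

variable {V : Type*} [NormedAddCommGroup V] [InnerProductSpace ℂ V] {q : ℝ}
  {A : Fin 3 → Fin 3 → Module.End ℂ V} {f : Fin 3 → ℤ} {L : V}

/-- Membership is required only when the coefficient is nonzero. This discards the truncated labels
k - 1, l - 1, r - 1 at zero, which would not have the shifted quantum numbers. -/
theorem Submodule.real_smul_mem {W : Submodule ℂ V} {v : V} (x : ℝ) (h : x ≠ 0 → v ∈ W) :
    x • v ∈ W := by
  by_cases hx : x = 0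
  · rw [hx, zero_smul]; exact W.zero_mem
  · rw [← Complex.coe_smul]; exact W.smul_mem _ (h hx)

theorem ne_zero_of_qNum_ne_zero {n : ℕ} (h : qNum q n ≠ 0) : n ≠ 0 := fun h0 =>
  h (by rw [h0, Nat.cast_zero, qNum_zero])

namespace IsLowestWeightUIR

variable (hA : IsLowestWeightUIR q f A L) (hq : 0 < q) (hf : IsPositiveSignature f)
  (x : ULabel f)
include hA hq hf

theorem ket_13 : A 0 2 (uKet q A L x) =
    ∑ᶠ y ∈ {y : ULabel f | y.m3 = x.m3 - 1 ∧ (y.U = x.U + 1 / 2 ∨ y.U = x.U - 1 / 2) ∧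
      y.M = x.M + 1 / 2},
      inner ℂ (uKet q A L y) (A 0 2 (uKet q A L x)) • uKet q A L y := by
  refine (hA.orthonormal_ket hq hf).eq_finsum_mem_inner (hA.mem_span_of_spin hq _ x ?_)
  rw [hA.D_spin hq x.hk]
  refine Submodule.add_mem _ (Submodule.real_smul_mem _ fun _ => ?_)
    (Submodule.real_smul_mem _ fun h => ?_)
  · refine hA.spin_mem_span hq hf fun y hk hl hr => ⟨?_, Or.inl ?_, ?_⟩
    · simp only [ULabel.m3, hk, hl]; push_cast; ring
    · simp only [ULabel.U, hk, hl]; push_cast; ring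
    · simp only [ULabel.M, ULabel.U, hk, hl, hr]; push_cast; ring
  · have hr1 := ne_zero_of_qNum_ne_zero (right_ne_zero_of_mul h)
    refine hA.spin_mem_span hq hf fun y hk hl hr => ⟨?_, Or.inr ?_, ?_⟩
    · simp only [ULabel.m3, hk, hl]; push_cast; ring
    · simp only [ULabel.U, hk, hl]; push_cast; ring
    · have hr' : (y.r : ℝ) + 1 = x.r := by exact_mod_cast (show y.r + 1 = x.r by omega)
      simp only [ULabel.M, ULabel.U, hk, hl, ← hr']; push_cast; ring

theorem ket_23 : A 1 2 (uKet q A L x) =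
    ∑ᶠ y ∈ {y : ULabel f | y.m3 = x.m3 - 1 ∧ (y.U = x.U + 1 / 2 ∨ y.U = x.U - 1 / 2) ∧
      y.M = x.M - 1 / 2},
      inner ℂ (uKet q A L y) (A 1 2 (uKet q A L x)) • uKet q A L y := by
  refine (hA.orthonormal_ket hq hf).eq_finsum_mem_inner (hA.mem_span_of_spin hq _ x ?_)
  rw [hA.B_spin hq x.hk]
  refine Submodule.add_mem _ ?_ (Submodule.real_smul_mem _ fun h => ?_)
  · refine hA.spin_mem_span hq hf fun y hk hl hr => ⟨?_, Or.inr ?_, ?_⟩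
    · simp only [ULabel.m3, hk, hl]; push_cast; ring
    · simp only [ULabel.U, hk, hl]; push_cast; ring
    · simp only [ULabel.M, ULabel.U, hk, hl, hr]; push_cast; ring
  · refine hA.spin_mem_span hq hf fun y hk hl hr => ⟨?_, Or.inl ?_, ?_⟩
    · simp only [ULabel.m3, hk, hl]; push_cast; ring
    · simp only [ULabel.U, hk, hl]; push_cast; ring
    · simp only [ULabel.M, ULabel.U, hk, hl, hr]; push_cast; ring

theorem ket_31 : A 2 0 (uKet q A L x) =
    ∑ᶠ y ∈ {y : ULabel f | y.m3 = x.m3 + 1 ∧ (y.U = x.U + 1 / 2 ∨ y.U = x.U - 1 / 2) ∧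
      y.M = x.M - 1 / 2},
      inner ℂ (uKet q A L y) (A 2 0 (uKet q A L x)) • uKet q A L y := by
  refine (hA.orthonormal_ket hq hf).eq_finsum_mem_inner (hA.mem_span_of_spin hq _ x ?_)
  rw [hA.G_spin hq hf.1 x.hk]
  refine Submodule.add_mem _ (Submodule.real_smul_mem _ fun h => ?_)
    (Submodule.real_smul_mem _ fun h => ?_)
  · have hl1 := ne_zero_of_qNum_ne_zero (left_ne_zero_of_mul (right_ne_zero_of_mul h))
    refine hA.spin_mem_span hq hf fun y hk hl hr => ?_
    have hl2 : y.l + 1 = x.l := by omega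
    have hl' : (y.l : ℝ) + 1 = x.l := by exact_mod_cast hl2
    refine ⟨?_, Or.inr ?_, ?_⟩
    · simp only [ULabel.m3, hk, ← hl2]; push_cast; ring
    · simp only [ULabel.U, hk, ← hl']; ring
    · simp only [ULabel.M, ULabel.U, hk, ← hl', hr]; ring
  · have hk1 : x.k ≠ 0 := fun h0 => h (by rw [h0, Nat.cast_zero, qNum_zero]; simp)
    refine hA.spin_mem_span hq hf fun y hk hl hr => ?_
    have hk2 : y.k + 1 = x.k := by omega
    have hk' : (y.k : ℝ) + 1 = x.k := by exact_mod_cast hk2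
    refine ⟨?_, Or.inl ?_, ?_⟩
    · simp only [ULabel.m3, ← hk2, hl]; push_cast; ring
    · simp only [ULabel.U, ← hk', hl]; ring
    · simp only [ULabel.M, ULabel.U, ← hk', hl, hr]; push_cast; ring

theorem ket_32 : A 2 1 (uKet q A L x) =
    ∑ᶠ y ∈ {y : ULabel f | y.m3 = x.m3 + 1 ∧ (y.U = x.U + 1 / 2 ∨ y.U = x.U - 1 / 2) ∧
      y.M = x.M + 1 / 2},
      inner ℂ (uKet q A L y) (A 2 1 (uKet q A L x)) • uKet q A L y := by
  refine (hA.orthonormal_ket hq hf).eq_finsum_mem_inner (hA.mem_span_of_spin hq _ x ?_)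
  rw [hA.C_spin hq hf.1 x.hk]
  refine Submodule.add_mem _ (Submodule.real_smul_mem _ fun h => ?_)
    (Submodule.real_smul_mem _ fun h => ?_)
  · have h1 := left_ne_zero_of_mul (neg_ne_zero.1 h)
    have hr1 := ne_zero_of_qNum_ne_zero (left_ne_zero_of_mul h1)
    have hl1 := ne_zero_of_qNum_ne_zero (right_ne_zero_of_mul h1)
    refine hA.spin_mem_span hq hf fun y hk hl hr => ?_
    have hl2 : y.l + 1 = x.l := by omega
    have hl' : (y.l : ℝ) + 1 = x.l := by exact_mod_cast hl2
    have hr' : (y.r : ℝ) + 1 = x.r := by exact_mod_cast (show y.r + 1 = x.r by omega)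
    refine ⟨?_, Or.inr ?_, ?_⟩
    · simp only [ULabel.m3, hk, ← hl2]; push_cast; ring
    · simp only [ULabel.U, hk, ← hl']; ring
    · simp only [ULabel.M, ULabel.U, hk, ← hl', ← hr']; ring
  · have hk1 : x.k ≠ 0 := fun h0 => h (by rw [h0, Nat.cast_zero, qNum_zero]; simp)
    refine hA.spin_mem_span hq hf fun y hk hl hr => ?_
    have hk2 : y.k + 1 = x.k := by omega
    have hk' : (y.k : ℝ) + 1 = x.k := by exact_mod_cast hk2
    refine ⟨?_, Or.inl ?_, ?_⟩
    · simp only [ULabel.m3, ← hk2, hl]; push_cast; ring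
    · simp only [ULabel.U, ← hk', hl]; ring
    · simp only [ULabel.M, ULabel.U, ← hk', hl, hr]; ring

omit hf in
theorem weight_ket : IsWeightVector A
    ![f 0 + x.l - (x.U - x.M), f 1 + x.k + (x.U - x.M), x.m3] (uKet q A L x) := by
  have e : x.U - x.M = x.r := by rw [ULabel.M]; ring
  rw [hA.ket_eq hq]
  refine ((hA.weight_spinVec x.k x.l x.r).smul _).congr ?_ ?_ ?_
  · rw [e]
  · rw [e]
  · rw [ULabel.m3]; push_cast; ring

/-- The span is invariant because each generator maps spin vectors to combinations of spin vectors,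
and it is nonzero because it contains L. -/
theorem span_ket : Submodule.span ℂ (Set.range (uKet q A L : ULabel f → V)) = ⊤ := by
  rw [← Set.image_univ]
  have hmem : ∀ k l r, spinVec q f A L k l r ∈
      Submodule.span ℂ (uKet q A L '' (Set.univ : Set (ULabel f))) := fun k l r =>
    hA.spin_mem_span hq hf fun _ _ _ _ => trivial
  refine (hA.irreducible _ fun i j v hv => ?_).resolve_left fun h => ?_
  · refine (Submodule.span_le (p := Submodule.comap (A i j)
      (Submodule.span ℂ (uKet q A L '' (Set.univ : Set (ULabel f)))))).2 ?_ hv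
    rintro _ ⟨x, -, rfl⟩
    have key : A i j (spinVec q f A L x.k x.l x.r) ∈
        Submodule.span ℂ (uKet q A L '' (Set.univ : Set (ULabel f))) := by
      by_cases hij : i = j
      · subst hij
        rw [hA.weight_spinVec x.k x.l x.r i]
        exact Submodule.smul_mem _ _ (hmem _ _ _)
      · fin_cases i <;> fin_cases j <;> first | exact absurd rfl hij | skip
        · exact hA.E_spin hq x.hk _ _ ▸ Submodule.real_smul_mem _ fun _ => hmem _ _ _
        · exact hA.D_spin hq x.hk _ _ ▸ Submodule.add_mem _
            (Submodule.real_smul_mem _ fun _ => hmem _ _ _)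
            (Submodule.real_smul_mem _ fun _ => hmem _ _ _)
        · exact (F_spin x.k x.l x.r : A 1 0 _ = _) ▸ hmem _ _ _
        · exact hA.B_spin hq x.hk _ _ ▸ Submodule.add_mem _ (hmem _ _ _)
            (Submodule.real_smul_mem _ fun _ => hmem _ _ _)
        · exact hA.G_spin hq hf.1 x.hk _ _ ▸ Submodule.add_mem _
            (Submodule.real_smul_mem _ fun _ => hmem _ _ _)
            (Submodule.real_smul_mem _ fun _ => hmem _ _ _)
        · exact hA.C_spin hq hf.1 x.hk _ _ ▸ Submodule.add_mem _
            (Submodule.real_smul_mem _ fun _ => hmem _ _ _)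
            (Submodule.real_smul_mem _ fun _ => hmem _ _ _)
    exact hA.mem_span_of_spin hq _ x key
  · have h0 := hmem 0 0 0
    rw [h, Submodule.mem_bot] at h0
    have hL : L = 0 := by simpa [spinVec, highestVec] using h0
    simpa [hL] using hA.norm_one

end IsLowestWeightUIR

end Action

/-! ### Assembly: quantum-number shifts are translated into shifts of k, l, r. -/

theorem mainTheorem4 {V : Type*} [NormedAddCommGroup V] [InnerProductSpace ℂ V]
    (q : ℝ) (hq : 0 < q) (f : Fin 3 → ℤ) (hf : IsPositiveSignature f)
    (A : Fin 3 → Fin 3 → Module.End ℂ V) (L : V) (hA : IsLowestWeightUIR q f A L) :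
    let ket : ULabel f → V := uKet q A L
    -- the kets form an orthonormal basis of weight vectors
    Orthonormal ℂ ket ∧ Submodule.span ℂ (Set.range ket) = ⊤ ∧
    (∀ x : ULabel f, IsWeightVector A
      ![f 0 + x.l - (x.U - x.M), f 1 + x.k + (x.U - x.M), x.m3] (ket x)) ∧
    -- the action of the U-spin generators
    (∀ x y : ULabel f, y.m3 = x.m3 → y.U = x.U → y.M = x.M + 1 →
      A 0 1 (ket x) = ((√(qNum q (x.U - x.M) * qNum q (x.U + x.M + 1)) : ℝ) : ℂ) • ket y) ∧
    (∀ x : ULabel f, x.M = x.U → A 0 1 (ket x) = 0) ∧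
    (∀ x y : ULabel f, y.m3 = x.m3 → y.U = x.U → y.M = x.M - 1 →
      A 1 0 (ket x) = ((√(qNum q (x.U + x.M) * qNum q (x.U - x.M + 1)) : ℝ) : ℂ) • ket y) ∧
    (∀ x : ULabel f, x.M = -x.U → A 1 0 (ket x) = 0) ∧
    -- the noncompact generators shift m₃ by ∓1 and U, M by ±1/2
    (∀ x : ULabel f, A 0 2 (ket x) =
      ∑ᶠ y ∈ {y : ULabel f | y.m3 = x.m3 - 1 ∧ (y.U = x.U + 1 / 2 ∨ y.U = x.U - 1 / 2) ∧
        y.M = x.M + 1 / 2}, inner ℂ (ket y) (A 0 2 (ket x)) • ket y) ∧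
    (∀ x : ULabel f, A 1 2 (ket x) =
      ∑ᶠ y ∈ {y : ULabel f | y.m3 = x.m3 - 1 ∧ (y.U = x.U + 1 / 2 ∨ y.U = x.U - 1 / 2) ∧
        y.M = x.M - 1 / 2}, inner ℂ (ket y) (A 1 2 (ket x)) • ket y) ∧
    (∀ x : ULabel f, A 2 0 (ket x) =
      ∑ᶠ y ∈ {y : ULabel f | y.m3 = x.m3 + 1 ∧ (y.U = x.U + 1 / 2 ∨ y.U = x.U - 1 / 2) ∧
        y.M = x.M - 1 / 2}, inner ℂ (ket y) (A 2 0 (ket x)) • ket y) ∧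
    (∀ x : ULabel f, A 2 1 (ket x) =
      ∑ᶠ y ∈ {y : ULabel f | y.m3 = x.m3 + 1 ∧ (y.U = x.U + 1 / 2 ∨ y.U = x.U - 1 / 2) ∧
        y.M = x.M + 1 / 2}, inner ℂ (ket y) (A 2 1 (ket x)) • ket y) ∧
    -- the matrix elements
    (∀ x y : ULabel f, y.m3 = x.m3 - 1 → y.U = x.U + 1 / 2 → y.M = x.M + 1 / 2 →
      inner ℂ (ket y) (A 0 2 (ket x)) =
        ((q ^ (-x.U + x.M) * √((qNum q (x.l + 1) * qNum q (f 0 - f 2 + x.l) *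
            qNum q (2 * x.U + x.k + 2) * qNum q (x.U + x.M + 1)) /
          (qNum q (2 * x.U + 1) * qNum q (2 * x.U + 2))) : ℝ) : ℂ)) ∧
    (∀ x y : ULabel f, y.m3 = x.m3 - 1 → y.U = x.U + 1 / 2 → y.M = x.M - 1 / 2 →
      inner ℂ (ket y) (A 1 2 (ket x)) =
        ((√((qNum q (x.l + 1) * qNum q (f 0 - f 2 + x.l) *
            qNum q (2 * x.U + x.k + 2) * qNum q (x.U - x.M + 1)) /
          (qNum q (2 * x.U + 1) * qNum q (2 * x.U + 2))) : ℝ) : ℂ)) ∧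
    (∀ x y : ULabel f, y.m3 = x.m3 - 1 → y.U = x.U - 1 / 2 → y.M = x.M + 1 / 2 →
      inner ℂ (ket y) (A 0 2 (ket x)) =
        ((-q ^ (x.U + x.M + 1) * √((qNum q (x.k + 1) * qNum q (f 1 - f 2 + x.k - 1) *
            qNum q (2 * x.U - x.l) * qNum q (x.U - x.M)) /
          (qNum q (2 * x.U) * qNum q (2 * x.U + 1))) : ℝ) : ℂ)) ∧
    (∀ x y : ULabel f, y.m3 = x.m3 - 1 → y.U = x.U - 1 / 2 → y.M = x.M - 1 / 2 →
      inner ℂ (ket y) (A 1 2 (ket x)) =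
        ((√((qNum q (x.k + 1) * qNum q (f 1 - f 2 + x.k - 1) *
            qNum q (2 * x.U - x.l) * qNum q (x.U + x.M)) /
          (qNum q (2 * x.U) * qNum q (2 * x.U + 1))) : ℝ) : ℂ)) ∧
    (∀ x y : ULabel f, y.m3 = x.m3 + 1 → y.U = x.U - 1 / 2 → y.M = x.M - 1 / 2 →
      inner ℂ (ket y) (A 2 0 (ket x)) =
        ((-q ^ (x.U - x.M) * √((qNum q x.l * qNum q (f 0 - f 2 + x.l - 1) *
            qNum q (2 * x.U + x.k + 1) * qNum q (x.U + x.M)) /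
          (qNum q (2 * x.U) * qNum q (2 * x.U + 1))) : ℝ) : ℂ)) ∧
    (∀ x y : ULabel f, y.m3 = x.m3 + 1 → y.U = x.U - 1 / 2 → y.M = x.M + 1 / 2 →
      inner ℂ (ket y) (A 2 1 (ket x)) =
        ((-√((qNum q x.l * qNum q (f 0 - f 2 + x.l - 1) *
            qNum q (2 * x.U + x.k + 1) * qNum q (x.U - x.M)) /
          (qNum q (2 * x.U) * qNum q (2 * x.U + 1))) : ℝ) : ℂ)) ∧
    (∀ x y : ULabel f, y.m3 = x.m3 + 1 → y.U = x.U + 1 / 2 → y.M = x.M - 1 / 2 →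
      inner ℂ (ket y) (A 2 0 (ket x)) =
        ((q ^ (-x.U - x.M - 1) * √((qNum q x.k * qNum q (f 1 - f 2 + x.k - 2) *
            qNum q (2 * x.U - x.l + 1) * qNum q (x.U - x.M + 1)) /
          (qNum q (2 * x.U + 1) * qNum q (2 * x.U + 2))) : ℝ) : ℂ)) ∧
    (∀ x y : ULabel f, y.m3 = x.m3 + 1 → y.U = x.U + 1 / 2 → y.M = x.M + 1 / 2 →
      inner ℂ (ket y) (A 2 1 (ket x)) =
        ((-√((qNum q x.k * qNum q (f 1 - f 2 + x.k - 2) *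
            qNum q (2 * x.U - x.l + 1) * qNum q (x.U + x.M + 1)) /
          (qNum q (2 * x.U + 1) * qNum q (2 * x.U + 2))) : ℝ) : ℂ)) := by

  have shift : ∀ (x y : ULabel f) (d e g : ℤ), y.m3 = x.m3 + d → y.U = x.U + e / 2 →
      y.M = x.M + g / 2 → 2 * (y.k : ℤ) = 2 * x.k - d - e ∧ 2 * (y.l : ℤ) = 2 * x.l - d + e ∧
      2 * (y.r : ℤ) = 2 * x.r + e - g := fun _ _ _ _ _ => ULabel.shift_eq
  have hUM : ∀ x : ULabel f, x.U - x.M = x.r := fun x => by rw [ULabel.M]; ring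
  have hUM' : ∀ x : ULabel f, x.U + x.M = (f 0 : ℝ) - f 1 - x.k + x.l - x.r := fun x => by
    rw [ULabel.M, ULabel.U]; ring
  refine ⟨hA.orthonormal_ket hq hf, hA.span_ket hq hf, hA.weight_ket hq, ?_, ?_, ?_, ?_,
    hA.ket_13 hq hf, hA.ket_23 hq hf, hA.ket_31 hq hf, hA.ket_32 hq hf, ?_, ?_, ?_, ?_, ?_, ?_, ?_,
    ?_⟩
  · intro x y h1 h2 h3
    obtain ⟨hk, hl, hr⟩ := shift x y 0 0 2 (by rw [h1]; ring) (by rw [h2]; simp) (by rw [h3]; simp)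
    have hk : y.k = x.k := by omega
    have hl : y.l = x.l := by omega
    have hr : y.r + 1 = x.r := by omega
    have hr' : (y.r : ℝ) + 1 = x.r := by exact_mod_cast hr
    have hR := hA.norm_sq_spin_r hq (l := x.l) (r := y.r) x.hk
    have e : (f 0 : ℝ) - f 1 - x.k + x.l - y.r = (f 0 : ℝ) - f 1 - x.k + x.l - x.r + 1 := by
      rw [← hr']; ring
    rw [hr, hr', e] at hR
    rw [hUM, hUM']
    refine hA.apply_ket hq hf x y _
      (by rw [hk, hl, show y.r = x.r - 1 by omega]; exact hA.E_spin hq x.hk x.l x.r)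
      (mul_nonneg (qNum_nonneg hq x.r.cast_nonneg)
        (qNum_nonneg hq (by linarith [x.r_le]))) ?_
    rw [hk, hl, hR]
    ring
  · intro x h
    have hr : x.r = 0 := by
      have := hUM x
      rw [h, sub_self] at this
      exact_mod_cast this.symm
    show A 0 1 (uKet q A L x) = 0
    rw [hA.ket_eq hq, LinearMap.map_smul_of_tower, hA.E_spin hq x.hk, hr, Nat.cast_zero, qNum_zero,
      zero_mul, zero_smul, smul_zero]
  · intro x y h1 h2 h3
    obtain ⟨hk, hl, hr⟩ := shift x y 0 0 (-2) (by rw [h1]; ring) (by rw [h2]; simp)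
      (by rw [h3]; push_cast; ring)
    have hk : y.k = x.k := by omega
    have hl : y.l = x.l := by omega
    have hr : y.r = x.r + 1 := by omega
    have hR := hA.norm_sq_spin_r hq (l := x.l) (r := x.r) x.hk
    rw [hUM, hUM']
    refine hA.apply_ket hq hf x y _
      (by rw [hk, hl, hr, one_smul]; exact IsLowestWeightUIR.F_spin _ _ _) zero_le_one ?_
    rw [hk, hl, hr, hR]
    ring
  · intro x h
    have hr : (x.r : ℝ) = (f 0 : ℝ) - f 1 - x.k + x.l := by
      have := hUM' x
      rw [h] at this
      linarith
    have hr' : (x.r : ℤ) = f 0 - f 1 - x.k + x.l := by exact_mod_cast hr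
    show A 1 0 (uKet q A L x) = 0
    -- M = -U means r = 2U, so F leads to r + 1 > 2U, where the spin vector vanishes.
    rw [hA.ket_eq hq, LinearMap.map_smul_of_tower, IsLowestWeightUIR.F_spin,
      hA.spin_eq_zero hq hf.1 (k := x.k) (l := x.l) (r := x.r + 1) (by push_cast; omega),
      smul_zero]
  · intro x y h1 h2 h3
    obtain ⟨hk, hl, hr⟩ := shift x y (-1) 1 1 (by rw [h1]; ring) (by rw [h2]; simp) (by rw [h3]; simp)
    exact hA.inner_13_l hq hf x y (by omega) (by omega) (by omega)
  · intro x y h1 h2 h3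
    obtain ⟨hk, hl, hr⟩ := shift x y (-1) 1 (-1) (by rw [h1]; ring) (by rw [h2]; simp)
      (by rw [h3]; push_cast; ring)
    exact hA.inner_23_l hq hf x y (by omega) (by omega) (by omega)
  · intro x y h1 h2 h3
    obtain ⟨hk, hl, hr⟩ := shift x y (-1) (-1) 1 (by rw [h1]; ring) (by rw [h2]; push_cast; ring)
      (by rw [h3]; simp)
    exact hA.inner_13_k hq hf x y (by omega) (by omega) (by omega)
  · intro x y h1 h2 h3
    obtain ⟨hk, hl, hr⟩ := shift x y (-1) (-1) (-1) (by rw [h1]; ring) (by rw [h2]; push_cast; ring)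
      (by rw [h3]; push_cast; ring)
    exact hA.inner_23_k hq hf x y (by omega) (by omega) (by omega)
  · intro x y h1 h2 h3
    obtain ⟨hk, hl, hr⟩ := shift x y 1 (-1) (-1) h1 (by rw [h2]; push_cast; ring)
      (by rw [h3]; push_cast; ring)
    exact hA.inner_31_l hq hf x y (by omega) (by omega) (by omega)
  · intro x y h1 h2 h3
    obtain ⟨hk, hl, hr⟩ := shift x y 1 (-1) 1 h1 (by rw [h2]; push_cast; ring) (by rw [h3]; simp)
    exact hA.inner_32_l hq hf x y (by omega) (by omega) (by omega)
  · intro x y h1 h2 h3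
    obtain ⟨hk, hl, hr⟩ := shift x y 1 1 (-1) h1 (by rw [h2]; simp) (by rw [h3]; push_cast; ring)
    exact hA.inner_31_k hq hf x y (by omega) (by omega) (by omega)
  · intro x y h1 h2 h3
    obtain ⟨hk, hl, hr⟩ := shift x y 1 1 1 h1 (by rw [h2]; simp) (by rw [h3]; simp)
    exact hA.inner_32_k hq hf x y (by omega) (by omega) (by omega)
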